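/- Let $0<\theta_0<1$ be irrational and put $\lambda_0=e^{2\pi i\theta_0}$. Assume the Diophantine condition: there are $c>0$ and $N\ge 0$ with $$|\lambda_0^k-1|>c\,k^{-N}\qquad (k=1,2,\ldots).$$ Let $W\subset\mathbb{C}\times\mathbb{C}^2$ be an open set containing $(\lambda_0,0)$, and let $F(\lambda,z)=F_\lambda(z)$, with values in $\mathbb{C}^2$, be holomorphic in $(\lambda,z)\in W$, such that for every $\lambda$ with $(\lambda,0)\in W$ $$F_\lambda(z)=\bigl(\lambda z_1+O(|z|^2),\ z_2+O(|z|^2)\bigr)\qquad (z=(z_1,z_2)\to 0).$$ (Thus, for $\lambda$ near $\lambda_0$, the maps $F_\lambda$ are local holomorphic diffeomorphisms of $(\mathbb{C}^2,0)$ depending holomorphically on $\lambda$.) For real $r$ write $\lambda=\lambda(r)=re^{2\pi i\theta_0}$ and $F_r=F_{\lambda(r)}$. Then there are $\delta\in(0,1)$, $\rho>0$, $C$, and maps $\psi_r:\Delta(0,\rho)\to\mathbb{C}^2$, $1-\delta<r<1+\delta$, defined on the fixed disc $\Delta(0,\rho)=\{w\in\mathbb{C}:|w|<\rho\}$, such that: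 1. For every $r\in(1-\delta,1+\delta)$, $\psi_r$ is an injective holomorphic immersion with $\psi_r(0)=(0,0)$ and $\psi_r'(0)=(1,0)$; moreover $(\lambda,\psi_r(w))\in W$ for all $w\in\Delta(0,\rho)$, and $$F_r(\psi_r(w))=\psi_r(\lambda w)\qquad\text{whenever } w,\ \lambda w\in\Delta(0,\rho).$$ 2. $|\psi_r(w)|<C$ for all $w\in\Delta(0,\rho)$ and all $r\in(1-\delta,1+\delta)$. 3. The map $r\mapsto\psi_r$ is $C^1$ from $(1-\delta,1+\delta)$ to the space $\mathcal{O}(\Delta(0,\rho),\mathbb{C}^2)$ of holomorphic maps with the compact-open topology: the difference quotients $(\psi_s-\psi_r)/(s-r)$ converge, uniformly on compact subsets of $\Delta(0,\rho)$, as $s\to r$, to a holomorphic map $\partial_r\psi_r$, and $r\mapsto\partial_r\psi_r$ is continuous for uniform convergence on compact subsets. -/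

import Mathlib

open Filter Topology Asymptotics

/-- The point `r * exp(2πiθ)` of the complex plane. -/
noncomputable def rayPoint (θ r : ℝ) : ℂ :=
  (r : ℂ) * Complex.exp (2 * (Real.pi : ℂ) * Complex.I * (θ : ℂ))

/-- The Diophantine condition `|lam ^ k - 1| > c * k ^ (-N)` for all `k ≥ 1`, for some
constants `c > 0` and `N ≥ 0`. -/
def SiegelCondition (lam : ℂ) : Prop :=
  ∃ c : ℝ, 0 < c ∧ ∃ N : ℝ, 0 ≤ N ∧
    ∀ k : ℕ, 1 ≤ k → c * (k : ℝ) ^ (-N) < ‖lam ^ k - 1‖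

/-- Convergence in the compact-open topology of maps `U → ℂ²`: uniform convergence on every
compact subset of `U`. -/
def TendstoCompactOpen {ι : Type*} (f : ι → ℂ → ℂ × ℂ) (g : ℂ → ℂ × ℂ) (l : Filter ι)
    (U : Set ℂ) : Prop :=
  ∀ K : Set ℂ, K ⊆ U → IsCompact K → TendstoUniformlyOn f g l K

/-- The family `ψ r`, `r ∈ I`, is `C¹` as a map from `I ⊆ ℝ` to the space `𝒪(U, ℂ²)` of
holomorphic maps with the compact-open topology: every member is holomorphic on `U`, the
difference quotients in `r` converge in that space, and the derivative depends continuously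
on `r` in that space. -/
def IsC1HolomorphicFamily (ψ : ℝ → ℂ → ℂ × ℂ) (I : Set ℝ) (U : Set ℂ) : Prop :=
  (∀ r ∈ I, DifferentiableOn ℂ (ψ r) U) ∧
  ∃ dψ : ℝ → ℂ → ℂ × ℂ, ∀ r ∈ I,
    DifferentiableOn ℂ (dψ r) U ∧
    TendstoCompactOpen (fun s w => (s - r)⁻¹ • (ψ s w - ψ r w)) (dψ r) (𝓝[I \ {r}] r) U ∧
    TendstoCompactOpen dψ (dψ r) (𝓝[I] r) U

/-! Write the invariant curve as a pair of power series `(P, Q)` with linear part `(w, 0)`.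
Comparing coefficients of `w ^ k` in `F (ψ w) = ψ (lam * w)` gives, for `k ≥ 2`, a recursion in
which the `k`-th coefficients are those of the nonlinear part of `F` along `(P, Q)`, divided by `lam
^ k - lam` and `lam ^ k - 1`. The nonlinear part starts in degree two, so only earlier coefficients
enter and a unique formal solution exists as long as no divisor vanishes (`coeff_formalSol`).

Convergence is Siegel's small divisor argument. Unfolding the recursion produces trees whose inner
nodes carry divisors. By the Diophantine condition, indices whose divisor is at most `2 ^ (-m)` are
sparse: they are large and far apart, at scale `2 ^ (m / N)`. Brjuno's counting (`TreeCost.bound`)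
therefore allows at most a constant times `k * 2 ^ (-m / N)` such nodes in a tree with `k` leaves.
Summing over `m` yields weights `η k` of exponential growth that absorb one product of divisors at
each node (`exists_siegelWeight`). The weighted `ℓ¹` norm with weights `ρ ^ k / η k` is then
submultiplicative with a gain, and an induction on the order of truncation bounds the coefficients
geometrically (`norm_coeff_le_of_recursion`).

For the dependence on `r`, radial motion is harmless: if `‖u‖ = 1` and `t ≥ 0`, then `‖t * u - 1‖ ≥
‖u - 1‖ / 2`. So the estimates hold uniformly along the ray, on both sides of the unit circle. The
`k`-th coefficient uses only finitely many divisors, hence it is holomorphic, with the same bound,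
on a disc of radius `τ / (k + 1) ^ (N + 1)` around each `r` (`invariantSeries_tube`). Cauchy
estimates for two derivatives in `r` cost only a power of `k + 1`, which a smaller disc in `w`
absorbs (`isC1HolomorphicFamily_tsum`). On that disc the curve is so close to `w ↦ (w, 0)` that it
is an injective immersion. -/

/-! ### Counting marked nodes in binary trees -/

/-- `TreeCost S k a` says that there is a binary tree with `k` leaves exactly `a` of whose
inner nodes carry a number of leaves belonging to `S`. -/
inductive TreeCost (S : Set ℕ) : ℕ → ℕ → Prop
  | leaf : TreeCost S 1 0
  | node {i j a b : ℕ} : TreeCost S i a → TreeCost S j b → i + j ∉ S → TreeCost S (i + j) (a + b)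
  | marked {i j a b : ℕ} : TreeCost S i a → TreeCost S j b → i + j ∈ S →
      TreeCost S (i + j) (a + b + 1)

theorem TreeCost.pos {S : Set ℕ} {k a : ℕ} (h : TreeCost S k a) : 1 ≤ k := by
  induction h <;> omega

theorem TreeCost.exists_cost (S : Set ℕ) {k : ℕ} (hk : 1 ≤ k) : ∃ a, TreeCost S k a := by
  induction k, hk using Nat.le_induction with
  | base => exact ⟨0, .leaf⟩
  | succ k hk ih =>
    obtain ⟨a, ha⟩ := ih
    by_cases h : k + 1 ∈ S
    · exact ⟨_, .marked ha .leaf h⟩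
    · exact ⟨_, .node ha .leaf h⟩

theorem TreeCost.eq_zero_of_one {S : Set ℕ} {k a : ℕ} (h : TreeCost S k a) (hk : k = 1) :
    a = 0 := by
  cases h with
  | leaf => rfl
  | node h₁ h₂ _ => have := h₁.pos; have := h₂.pos; omega
  | marked h₁ h₂ _ => have := h₁.pos; have := h₂.pos; omega

/-- Brjuno's counting lemma: if the elements of `S` are at least `Q` and have gaps at least `Q`,
then a tree with `k` leaves has at most `2 k / Q - 1` marked nodes, and none if `k < Q`. -/
theorem TreeCost.bound {S : Set ℕ} {Q : ℝ} (hQ₀ : 0 < Q) (hS : ∀ p ∈ S, Q ≤ p)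
    (hgap : ∀ p ∈ S, ∀ q ∈ S, q < p → Q ≤ (p : ℝ) - q) {k a : ℕ} (h : TreeCost S k a) :
    (((k : ℝ) < Q ∧ a = 0) ∨ (Q ≤ k ∧ (a + 1) * Q ≤ 2 * k)) ∧
      ∀ p ∈ S, k < p → (a + 2) * Q ≤ 2 * (p : ℝ) := by
  induction h with
  | leaf =>
    refine ⟨?_, fun p hp _ => ?_⟩
    · rcases lt_or_ge ((1 : ℕ) : ℝ) Q with h | h
      · exact .inl ⟨h, rfl⟩
      · right; push_cast at *; constructor <;> linarith
    · have := hS p hp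
      push_cast; linarith
  | @node i j a b h₁ h₂ hn ih₁ ih₂ =>
    obtain ⟨A₁, B₁⟩ := ih₁
    obtain ⟨A₂, B₂⟩ := ih₂
    have hi : (1 : ℝ) ≤ i := by exact_mod_cast h₁.pos
    have hj : (1 : ℝ) ≤ j := by exact_mod_cast h₂.pos
    refine ⟨?_, fun p hp hlt => ?_⟩
    · rcases A₁ with ⟨u₁, rfl⟩ | ⟨u₁, v₁⟩ <;> rcases A₂ with ⟨u₂, rfl⟩ | ⟨u₂, v₂⟩
      · rcases lt_or_ge ((i + j : ℕ) : ℝ) Q with h | h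
        · exact .inl ⟨h, rfl⟩
        · right; push_cast at *; constructor <;> linarith
      · right; push_cast at *; constructor <;> linarith
      · right; push_cast at *; constructor <;> linarith
      · right; push_cast at *; constructor <;> linarith
    · have C₁ := B₁ p hp (by omega)
      have C₂ := B₂ p hp (by omega)
      have hlt' : (i : ℝ) + j < p := by exact_mod_cast hlt
      rcases A₁ with ⟨u₁, rfl⟩ | ⟨u₁, v₁⟩ <;> rcases A₂ with ⟨u₂, rfl⟩ | ⟨u₂, v₂⟩ <;>
        push_cast at * <;> linarith
  | @marked i j a b h₁ h₂ hn ih₁ ih₂ =>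
    obtain ⟨A₁, B₁⟩ := ih₁
    obtain ⟨A₂, B₂⟩ := ih₂
    have hi := h₁.pos
    have hj := h₂.pos
    -- The second conjunct is what closes the induction: if only one child reaches size `Q`, its
    -- bound against the larger element `i + j` of `S` leaves room for the new mark.
    have C₁ := B₁ _ hn (by omega)
    have C₂ := B₂ _ hn (by omega)
    have hQ := hS _ hn
    have key : (((a + b + 1 : ℕ) : ℝ) + 1) * Q ≤ 2 * ((i + j : ℕ) : ℝ) := by
      rcases A₁ with ⟨u₁, rfl⟩ | ⟨u₁, v₁⟩ <;> rcases A₂ with ⟨u₂, rfl⟩ | ⟨u₂, v₂⟩ <;>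
        push_cast at * <;> linarith
    refine ⟨.inr ⟨hQ, key⟩, fun p hp hlt => ?_⟩
    have := hgap p hp _ hn hlt
    push_cast at *
    linarith

/-- The largest number of marked nodes of a binary tree with `k` leaves. -/
noncomputable def treeCount (S : Set ℕ) (k : ℕ) : ℕ := sSup {a | TreeCost S k a}

/-- The counting bound makes the supremum a maximum, so optimal trees with `i` and `j` leaves exist.
Joining them at a new root gives the superadditivity, with one extra mark when `i + j ∈ S`. -/
theorem exists_superadditive_counting {S : Set ℕ} {Q : ℝ} (hQ : 0 < Q) (hS : ∀ p ∈ S, Q ≤ p)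
    (hgap : ∀ p ∈ S, ∀ q ∈ S, q < p → Q ≤ (p : ℝ) - q) :
    treeCount S 0 = 0 ∧ treeCount S 1 = 0 ∧ (∀ k, (treeCount S k : ℝ) ≤ 2 * k * Q⁻¹) ∧
    (∀ i j, 1 ≤ i → 1 ≤ j → treeCount S i + treeCount S j ≤ treeCount S (i + j)) ∧
    (∀ i j, 1 ≤ i → 1 ≤ j → i + j ∈ S →
      1 + treeCount S i + treeCount S j ≤ treeCount S (i + j)) := by
  have hb : ∀ k a, TreeCost S k a → (a : ℝ) ≤ 2 * k * Q⁻¹ := fun k a h => by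
    rw [← div_eq_mul_inv, le_div_iff₀ hQ]
    have := h.pos
    rcases (h.bound hQ hS hgap).1 with ⟨_, rfl⟩ | ⟨_, h'⟩
    · simp
    · linarith
  have hbdd : ∀ k, BddAbove {a | TreeCost S k a} := fun k =>
    ⟨⌊2 * k * Q⁻¹⌋₊, fun a ha => Nat.le_floor (hb k a ha)⟩
  have hmem : ∀ k, 1 ≤ k → TreeCost S k (treeCount S k) := fun k hk =>
    Nat.sSup_mem (TreeCost.exists_cost S hk) (hbdd k)
  have h0 : treeCount S 0 = 0 := by
    have : {a | TreeCost S 0 a} = ∅ := by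
      ext a
      simp only [Set.mem_ofPred_eq, Set.mem_empty_iff_false, iff_false]
      intro h
      exact absurd h.pos (by norm_num)
    simp [treeCount, this]
  refine ⟨h0, (hmem 1 le_rfl).eq_zero_of_one rfl, fun k => ?_, fun i j hi hj => ?_,
    fun i j hi hj h => ?_⟩
  · rcases Nat.eq_zero_or_pos k with rfl | hk
    · simp [h0]
    · exact hb k _ (hmem k hk)
  · by_cases h : i + j ∈ S
    · exact (Nat.le_succ _).trans (le_csSup (hbdd _) (.marked (hmem i hi) (hmem j hj) h))
    · exact le_csSup (hbdd _) (.node (hmem i hi) (hmem j hj) h)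
  · have := le_csSup (hbdd _) (TreeCost.marked (hmem i hi) (hmem j hj) h)
    unfold treeCount at *
    omega

/-- Take `ν` to be the sum over all levels `m` of the maximal mark counts; it converges because
level `m` contributes at most `2 * k / Q m`. A node belonging to several levels is charged once for
each, so `ν` can serve as the base-two logarithm of a product of reciprocal divisors. -/
theorem exists_levelWeight {S : ℕ → Set ℕ} {Q : ℕ → ℝ} (hQ : ∀ m, 0 < Q m)
    (hS : ∀ m, ∀ p ∈ S m, Q m ≤ p)
    (hgap : ∀ m, ∀ p ∈ S m, ∀ q ∈ S m, q < p → Q m ≤ (p : ℝ) - q)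
    (hsum : Summable fun m => (Q m)⁻¹) :
    ∃ ν : ℕ → ℝ, ν 0 = 0 ∧ ν 1 = 0 ∧ (∀ k, ν k ≤ (2 * ∑' m, (Q m)⁻¹) * k) ∧
      ∀ i j, 1 ≤ i → 1 ≤ j → ∀ T : Finset ℕ, (∀ m ∈ T, i + j ∈ S m) →
        (T.card : ℝ) + ν i + ν j ≤ ν (i + j) := by
  have H := fun m => exists_superadditive_counting (hQ m) (hS m) (hgap m)
  have hs : ∀ k, Summable fun m => (treeCount (S m) k : ℝ) := fun k =>
    Summable.of_nonneg_of_le (fun m => by positivity) (fun m => (H m).2.2.1 k)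
      (hsum.mul_left (2 * (k : ℝ)))
  refine ⟨fun k => ∑' m, (treeCount (S m) k : ℝ), by simp [fun m => (H m).1],
    by simp [fun m => (H m).2.1], fun k => ?_, fun i j hi hj T hT => ?_⟩
  · calc ∑' m, (treeCount (S m) k : ℝ) ≤ ∑' m, 2 * (k : ℝ) * (Q m)⁻¹ :=
          (hs k).tsum_le_tsum (fun m => (H m).2.2.1 k) (hsum.mul_left _)
      _ = _ := by rw [tsum_mul_left]; ring
  · have hT' : Summable fun m => if m ∈ T then (1 : ℝ) else 0 :=
      summable_of_ne_finset_zero (s := T) fun m hm => by simp [hm]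
    have hcard : (T.card : ℝ) = ∑' m, if m ∈ T then (1 : ℝ) else 0 := by
      rw [tsum_eq_sum (s := T) fun m hm => by simp [hm]]
      simp
    rw [hcard, ← hT'.tsum_add (hs i), ← (hT'.add (hs i)).tsum_add (hs j)]
    refine ((hT'.add (hs i)).add (hs j)).tsum_le_tsum (fun m => ?_) (hs (i + j))
    by_cases hm : m ∈ T
    · have := (H m).2.2.2.2 i j hi hj (hT m hm)
      simp only [hm, if_true]
      exact_mod_cast this
    · have := (H m).2.2.2.1 i j hi hj
      simp only [hm, if_false, zero_add]
      exact_mod_cast this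

/-! ### Small divisors and Siegel's weights -/

/-- The reciprocal of the `k`-th small divisor of `lam`, cut off below at `1`. -/
noncomputable def smallDiv (lam : ℂ) (k : ℕ) : ℝ := max 1 ‖lam ^ k - 1‖⁻¹

theorem one_le_smallDiv (lam : ℂ) (k : ℕ) : 1 ≤ smallDiv lam k := le_max_left _ _

/-- Dyadic rounding: the size of a divisor is read off, up to a factor `2`, from the number of
levels `m` that it reaches. -/
theorem smallDiv_le_two_pow (lam : ℂ) (k : ℕ) :
    ∃ T : Finset ℕ, (∀ m ∈ T, ‖lam ^ k - 1‖ ≤ ((2 : ℝ) ^ m)⁻¹) ∧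
      smallDiv lam k ≤ 2 * 2 ^ (T.card : ℝ) := by
  obtain ⟨n, hn, hn'⟩ := exists_nat_pow_near (one_le_smallDiv lam k) (one_lt_two (α := ℝ))
  rcases le_total ‖lam ^ k - 1‖⁻¹ 1 with h | h
  · exact ⟨∅, by simp, by simp [smallDiv, h]⟩
  · refine ⟨Finset.range n, fun m hm => ?_, ?_⟩
    · have hpos : 0 < ‖lam ^ k - 1‖ := inv_pos.1 (one_pos.trans_le h)
      have h2 : (2 : ℝ) ^ m ≤ ‖lam ^ k - 1‖⁻¹ := by
        refine (pow_le_pow_right₀ one_le_two (Finset.mem_range.1 hm).le).trans (hn.trans ?_)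
        simp [smallDiv, h]
      exact (le_inv_comm₀ (by positivity) hpos).1 h2
    · rw [Finset.card_range, Real.rpow_natCast, ← pow_succ']
      exact hn'.le

/-- Siegel's lemma on small divisors. -/
theorem exists_siegelWeight {lam : ℂ} (hlam : ‖lam‖ = 1) {c : ℝ} (hc : 0 < c) {N : ℕ}
    (hN : N ≠ 0) (hd : ∀ k : ℕ, 1 ≤ k → c < k ^ N * ‖lam ^ k - 1‖) :
    ∃ η : ℕ → ℝ, η 0 = 1 ∧ η 1 = 1 ∧ (∀ k, 0 < η k) ∧ (∃ C : ℝ, 1 ≤ C ∧ ∀ k, η k ≤ C ^ k) ∧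
      ∀ i j, 1 ≤ i → 1 ≤ j →
        smallDiv lam (i + j - 1) * smallDiv lam (i + j) * (η i * η j) ≤ η (i + j) := by
  -- `κ` and `β` are chosen so that `Q m ^ N = c / 2 * 2 ^ m`. The half allows divisors up to `2 * 2
  -- ^ (-m)`, the size of a difference of two divisors of level `m`.
  set κ : ℝ := (c / 2) ^ ((N : ℝ)⁻¹) with hκ
  set β : ℝ := 2 ^ ((N : ℝ)⁻¹) with hβ
  have hκ0 : 0 < κ := by positivity
  have hβ0 : 0 < β := by positivity
  have hκN : κ ^ N = c / 2 := Real.rpow_inv_natCast_pow (by positivity) hN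
  have hβN : β ^ N = 2 := Real.rpow_inv_natCast_pow (by positivity) hN
  have hβ1 : 1 < β := Real.one_lt_rpow one_lt_two (by positivity)
  set Q : ℕ → ℝ := fun m => κ * β ^ m with hQdef
  have hQ : ∀ m, 0 < Q m := fun m => by positivity
  have hsum : Summable fun m => (Q m)⁻¹ := by
    have : (fun m => (Q m)⁻¹) = fun m => κ⁻¹ * (β⁻¹) ^ m := by
      ext m; simp [hQdef, mul_comm]
    rw [this]
    exact (summable_geometric_of_lt_one (by positivity) (inv_lt_one_of_one_lt₀ hβ1)).mul_left _
  have hQN : ∀ m, Q m ^ N = c / 2 * 2 ^ m := fun m => by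
    rw [hQdef, mul_pow, hκN, ← pow_mul, mul_comm m N, pow_mul, hβN]
  -- a divisor of size at most `2 * 2 ^ (-m)` has index at least `Q m`
  have hlow : ∀ m k : ℕ, 1 ≤ k → ‖lam ^ k - 1‖ ≤ 2 * ((2 : ℝ) ^ m)⁻¹ → Q m ≤ k := by
    intro m k hk h
    by_contra! hlt
    have h1 : (k : ℝ) ^ N ≤ Q m ^ N := pow_le_pow_left₀ (by positivity) hlt.le N
    have h2 := hd k hk
    have h3 : (k : ℝ) ^ N * ‖lam ^ k - 1‖ ≤ (c / 2 * 2 ^ m) * (2 * ((2 : ℝ) ^ m)⁻¹) := by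
      rw [← hQN]
      exact mul_le_mul h1 h (norm_nonneg _) (by have := hQ m; positivity)
    have h4 : (c / 2 * 2 ^ m) * (2 * ((2 : ℝ) ^ m)⁻¹) = c := by field_simp
    linarith
  -- Since `‖lam‖ = 1`, the divisor of `p - q` has the size of the difference of the divisors of `p`
  -- and `q`, so the lower bound on indices also bounds gaps.
  have hdiff : ∀ m p q : ℕ, q < p → ‖lam ^ p - 1‖ ≤ ((2 : ℝ) ^ m)⁻¹ →
      ‖lam ^ q - 1‖ ≤ ((2 : ℝ) ^ m)⁻¹ → Q m ≤ (p : ℝ) - q := by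
    intro m p q hqp hp hq
    have h := hlow m (p - q) (by omega) ?_
    · rwa [Nat.cast_sub hqp.le] at h
    · have h1 : lam ^ p - lam ^ q = lam ^ q * (lam ^ (p - q) - 1) := by
        rw [mul_sub, ← pow_add, mul_one, Nat.add_sub_cancel' hqp.le]
      have h2 : ‖lam ^ (p - q) - 1‖ = ‖lam ^ p - lam ^ q‖ := by
        rw [h1, norm_mul, norm_pow, hlam, one_pow, one_mul]
      have h3 : lam ^ p - lam ^ q = (lam ^ p - 1) - (lam ^ q - 1) := by ring
      rw [h2, h3]
      exact (norm_sub_le _ _).trans (by linarith)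
  set S : ℕ → Set ℕ := fun m => {k | 1 ≤ k ∧ ‖lam ^ k - 1‖ ≤ ((2 : ℝ) ^ m)⁻¹} with hS
  -- The shifted sets account for `lam ^ k - lam = lam * (lam ^ (k - 1) - 1)`. The condition `1 ≤ k
  -- - 1` inside `S m` excludes `k ≤ 1`, where truncated subtraction would mislead.
  set S' : ℕ → Set ℕ := fun m => {k | k - 1 ∈ S m} with hS'
  have hSQ : ∀ m, ∀ p ∈ S m, Q m ≤ p := fun m p hp => hlow m p hp.1 (hp.2.trans (by
    have : (0 : ℝ) < ((2 : ℝ) ^ m)⁻¹ := by positivity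
    linarith))
  obtain ⟨ν, hν0, hν1, hνb, hν⟩ := exists_levelWeight (S := S) hQ hSQ
    (fun m p hp q hq hqp => hdiff m p q hqp hp.2 hq.2) hsum
  obtain ⟨ν', hν0', hν1', hνb', hν'⟩ := exists_levelWeight (S := S') hQ
    (fun m p hp => (hSQ m _ hp).trans (by exact_mod_cast Nat.sub_le p 1))
    (fun m p hp q hq hqp => by
      have hp1 : 1 ≤ p - 1 := hp.1
      have hq1 : 1 ≤ q - 1 := hq.1
      have := hdiff m (p - 1) (q - 1) (by omega) hp.2 hq.2
      rwa [Nat.cast_sub (by omega), Nat.cast_sub (by omega), sub_sub_sub_cancel_right] at this)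
    hsum
  set A : ℝ := 2 * ∑' m, (Q m)⁻¹ with hA
  have hA0 : 0 ≤ A := mul_nonneg zero_le_two (tsum_nonneg fun m => (inv_pos.2 (hQ m)).le)
  -- A binary tree with `k` leaves has `k - 1` inner nodes; at each, `4` pays for the two factors
  -- `2` lost in dyadic rounding.
  refine ⟨fun k => 4 ^ (k - 1) * 2 ^ (ν k + ν' k), by simp [hν0, hν0'], by simp [hν1, hν1'],
    fun k => by positivity, ⟨4 * 2 ^ (A + A), ?_, fun k => ?_⟩, fun i j hi hj => ?_⟩
  · have : (1 : ℝ) ≤ 2 ^ (A + A) := Real.one_le_rpow one_le_two (by positivity)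
    linarith
  · rw [mul_pow, ← Real.rpow_natCast (2 ^ (A + A)), ← Real.rpow_mul zero_le_two]
    refine mul_le_mul (pow_le_pow_right₀ (by norm_num) (Nat.sub_le k 1))
      (Real.rpow_le_rpow_of_exponent_le one_le_two ?_) (by positivity) (by positivity)
    have := hνb k
    have := hνb' k
    linarith
  · obtain ⟨T, hT, hTe⟩ := smallDiv_le_two_pow lam (i + j)
    obtain ⟨T', hT', hTe'⟩ := smallDiv_le_two_pow lam (i + j - 1)
    have h1 := hν i j hi hj T fun m hm => ⟨by omega, hT m hm⟩
    have h2 := hν' i j hi hj T' fun m hm => ⟨by omega, hT' m hm⟩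
    have h4 : (4 : ℝ) ^ (i + j - 1) = 4 * (4 ^ (i - 1) * 4 ^ (j - 1)) := by
      rw [← pow_add, ← pow_succ']; congr 1; omega
    calc smallDiv lam (i + j - 1) * smallDiv lam (i + j) *
          ((4 ^ (i - 1) * 2 ^ (ν i + ν' i)) * (4 ^ (j - 1) * 2 ^ (ν j + ν' j)))
        ≤ (2 * 2 ^ (T'.card : ℝ)) * (2 * 2 ^ (T.card : ℝ)) *
          ((4 ^ (i - 1) * 2 ^ (ν i + ν' i)) * (4 ^ (j - 1) * 2 ^ (ν j + ν' j))) := by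
          have := one_le_smallDiv lam (i + j)
          gcongr
      _ = 4 ^ (i + j - 1) * 2 ^ ((T'.card : ℝ) + T.card + (ν i + ν' i) + (ν j + ν' j)) := by
          simp only [h4, Real.rpow_add two_pos]
          ring
      _ ≤ 4 ^ (i + j - 1) * 2 ^ (ν (i + j) + ν' (i + j)) := by
          refine mul_le_mul_of_nonneg_left
            (Real.rpow_le_rpow_of_exponent_le one_le_two ?_) (by positivity)
          linarith

/-! ### The formal invariant curve -/

open PowerSeries in
/-- The `k`-th coefficient of the part of order at least two of `∑ c p q P ^ p Q ^ q`. -/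
noncomputable def nonlinCoeff (c : ℕ → ℕ → ℂ) (P Q : PowerSeries ℂ) (k : ℕ) : ℂ :=
  ∑ x ∈ (Finset.range (k + 1) ×ˢ Finset.range (k + 1)).filter (fun x => 2 ≤ x.1 + x.2),
    c x.1 x.2 * coeff k (P ^ x.1 * Q ^ x.2)

/-- Splitting one factor off a monomial of degree at least two leaves a cofactor that still has
positive order. This exhibits every nonlinear term as a single product of two series without
constant term, the shape needed both for the recursion and for the weighted estimate. -/
theorem exists_pow_mul_pow_split {p q : ℕ} (h : 2 ≤ p + q) :
    ∃ p' q', 1 ≤ p' + q' ∧ p' + q' + 1 = p + q ∧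
      ((∀ P Q : PowerSeries ℂ, P ^ p * Q ^ q = P * (P ^ p' * Q ^ q')) ∨
        ∀ P Q : PowerSeries ℂ, P ^ p * Q ^ q = Q * (P ^ p' * Q ^ q')) := by
  rcases p with _ | p
  · refine ⟨0, q - 1, by omega, by omega, .inr fun P Q => ?_⟩
    obtain ⟨q, rfl⟩ : ∃ r, q = r + 1 := ⟨q - 1, by omega⟩
    simp [pow_succ']
  · exact ⟨p, q, by omega, by omega, .inl fun P Q => by ring⟩

theorem X_dvd_pow_mul_pow {P Q : PowerSeries ℂ} (hP : PowerSeries.X ∣ P)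
    (hQ : PowerSeries.X ∣ Q) {p q : ℕ} (h : 1 ≤ p + q) : PowerSeries.X ∣ P ^ p * Q ^ q := by
  rcases p with _ | p
  · exact (hQ.trans (dvd_pow_self Q (by omega))).trans (Dvd.intro_left _ rfl)
  · exact (hP.trans (dvd_pow_self P (by omega))).trans (Dvd.intro _ rfl)

theorem X_pow_dvd_pow_mul_pow {P Q : PowerSeries ℂ} (hP : PowerSeries.X ∣ P)
    (hQ : PowerSeries.X ∣ Q) (p q : ℕ) : PowerSeries.X ^ (p + q) ∣ P ^ p * Q ^ q := by
  rw [pow_add]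
  exact mul_dvd_mul (pow_dvd_pow_of_dvd hP p) (pow_dvd_pow_of_dvd hQ q)

theorem dvd_pow_mul_pow_sub {D P Q P' Q' : PowerSeries ℂ} (hP : D ∣ P - P') (hQ : D ∣ Q - Q')
    (p q : ℕ) : D ∣ P ^ p * Q ^ q - P' ^ p * Q' ^ q := by
  have h1 : D ∣ P ^ p - P' ^ p := hP.trans (sub_dvd_pow_sub_pow _ _ p)
  have h2 : D ∣ Q ^ q - Q' ^ q := hQ.trans (sub_dvd_pow_sub_pow _ _ q)
  have : P ^ p * Q ^ q - P' ^ p * Q' ^ q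
      = (P ^ p - P' ^ p) * Q ^ q + P' ^ p * (Q ^ q - Q' ^ q) := by ring
  rw [this]
  exact dvd_add (h1.mul_right _) (h2.mul_left _)

theorem X_pow_succ_dvd_mul_sub {A B A' B' : PowerSeries ℂ} {k : ℕ} (hA : PowerSeries.X ∣ A)
    (hB' : PowerSeries.X ∣ B') (hAA' : PowerSeries.X ^ k ∣ A - A')
    (hBB' : PowerSeries.X ^ k ∣ B - B') : PowerSeries.X ^ (k + 1) ∣ A * B - A' * B' := by
  have : A * B - A' * B' = A * (B - B') + (A - A') * B' := by ring
  rw [this]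
  refine dvd_add ?_ ?_
  · rw [pow_succ']; exact mul_dvd_mul hA hBB'
  · rw [pow_succ]; exact mul_dvd_mul hAA' hB'

/-- In a product of two series of positive order, agreement of the factors modulo `X ^ k` improves
to agreement modulo `X ^ (k + 1)`. Hence the coefficient at `k` sees only coefficients below `k`,
which makes the recursion solvable. -/
theorem nonlinCoeff_congr (c : ℕ → ℕ → ℂ) {P Q P' Q' : PowerSeries ℂ} {k : ℕ}
    (hP : PowerSeries.X ∣ P) (hQ : PowerSeries.X ∣ Q)
    (hP' : PowerSeries.X ∣ P') (hQ' : PowerSeries.X ∣ Q')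
    (hPP : PowerSeries.X ^ k ∣ P - P') (hQQ : PowerSeries.X ^ k ∣ Q - Q') :
    nonlinCoeff c P Q k = nonlinCoeff c P' Q' k := by
  refine Finset.sum_congr rfl fun x hx => ?_
  obtain ⟨p', q', h1, -, h2⟩ := exists_pow_mul_pow_split (Finset.mem_filter.1 hx).2
  have hd : PowerSeries.X ^ (k + 1) ∣ P ^ x.1 * Q ^ x.2 - P' ^ x.1 * Q' ^ x.2 := by
    rcases h2 with h2 | h2 <;> rw [h2, h2]
    · exact X_pow_succ_dvd_mul_sub hP (X_dvd_pow_mul_pow hP' hQ' h1) hPP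
        (dvd_pow_mul_pow_sub hPP hQQ _ _)
    · exact X_pow_succ_dvd_mul_sub hQ (X_dvd_pow_mul_pow hP' hQ' h1) hQQ
        (dvd_pow_mul_pow_sub hPP hQQ _ _)
  have := PowerSeries.X_pow_dvd_iff.1 hd k (Nat.lt_succ_self k)
  rw [map_sub, sub_eq_zero] at this
  rw [this]

/-- Successive approximations to the formal solution of the invariance equation. -/
noncomputable def formalApprox (u₁ u₂ : ℕ → ℂ) (c₁ c₂ : ℕ → ℕ → ℂ) :
    ℕ → PowerSeries ℂ × PowerSeries ℂ
  | 0 => (PowerSeries.X, 0)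
  | n + 1 =>
    ((formalApprox u₁ u₂ c₁ c₂ n).1 + PowerSeries.monomial (n + 2) (u₁ (n + 2) *
        nonlinCoeff c₁ (formalApprox u₁ u₂ c₁ c₂ n).1 (formalApprox u₁ u₂ c₁ c₂ n).2 (n + 2)),
      (formalApprox u₁ u₂ c₁ c₂ n).2 + PowerSeries.monomial (n + 2) (u₂ (n + 2) *
        nonlinCoeff c₂ (formalApprox u₁ u₂ c₁ c₂ n).1 (formalApprox u₁ u₂ c₁ c₂ n).2 (n + 2)))

theorem X_pow_dvd_monomial {m n : ℕ} (h : m ≤ n) (a : ℂ) :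
    (PowerSeries.X : PowerSeries ℂ) ^ m ∣ PowerSeries.monomial n a := by
  rw [PowerSeries.X_pow_dvd_iff]
  intro i hi
  rw [PowerSeries.coeff_monomial, if_neg (by omega)]

section Formal

variable (u₁ u₂ : ℕ → ℂ) (c₁ c₂ : ℕ → ℕ → ℂ)

theorem X_dvd_formalApprox (n : ℕ) : PowerSeries.X ∣ (formalApprox u₁ u₂ c₁ c₂ n).1 ∧
    PowerSeries.X ∣ (formalApprox u₁ u₂ c₁ c₂ n).2 := by
  induction n with
  | zero => simp [formalApprox]
  | succ n ih =>
    have h := fun a => pow_one (PowerSeries.X : PowerSeries ℂ) ▸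
      X_pow_dvd_monomial (show 1 ≤ n + 2 by omega) a
    exact ⟨dvd_add ih.1 (h _), dvd_add ih.2 (h _)⟩

theorem formalApprox_sub_dvd {m n : ℕ} (h : n ≤ m) :
    PowerSeries.X ^ (n + 2) ∣ (formalApprox u₁ u₂ c₁ c₂ m).1 - (formalApprox u₁ u₂ c₁ c₂ n).1 ∧
    PowerSeries.X ^ (n + 2) ∣
      (formalApprox u₁ u₂ c₁ c₂ m).2 - (formalApprox u₁ u₂ c₁ c₂ n).2 := by
  induction m, h using Nat.le_induction with
  | base => simp
  | succ m hm ih =>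
    simp only [formalApprox, add_sub_right_comm]
    exact ⟨dvd_add ih.1 (X_pow_dvd_monomial (by omega) _),
      dvd_add ih.2 (X_pow_dvd_monomial (by omega) _)⟩

theorem coeff_formalApprox_eq_zero {n k : ℕ} (h : n + 2 ≤ k) :
    PowerSeries.coeff k (formalApprox u₁ u₂ c₁ c₂ n).1 = 0 ∧
    PowerSeries.coeff k (formalApprox u₁ u₂ c₁ c₂ n).2 = 0 := by
  induction n with
  | zero => simp [formalApprox, PowerSeries.coeff_X]; omega
  | succ n ih =>
    have h' := ih (by omega)
    simp only [formalApprox, map_add, h'.1, h'.2, PowerSeries.coeff_monomial,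
      if_neg (show ¬ k = n + 2 by omega), add_zero, and_self]

/-- The formal solution of the invariance equation. -/
noncomputable def formalSol : PowerSeries ℂ × PowerSeries ℂ :=
  (PowerSeries.mk fun k => PowerSeries.coeff k (formalApprox u₁ u₂ c₁ c₂ k).1,
    PowerSeries.mk fun k => PowerSeries.coeff k (formalApprox u₁ u₂ c₁ c₂ k).2)

theorem coeff_formalApprox_eq {m n k : ℕ} (hm : k ≤ m + 1) (hn : k ≤ n + 1) :
    PowerSeries.coeff k (formalApprox u₁ u₂ c₁ c₂ m).1
      = PowerSeries.coeff k (formalApprox u₁ u₂ c₁ c₂ n).1 ∧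
    PowerSeries.coeff k (formalApprox u₁ u₂ c₁ c₂ m).2
      = PowerSeries.coeff k (formalApprox u₁ u₂ c₁ c₂ n).2 := by
  wlog h : n ≤ m generalizing m n
  · exact ⟨(this hn hm (by omega)).1.symm, (this hn hm (by omega)).2.symm⟩
  have hd := formalApprox_sub_dvd u₁ u₂ c₁ c₂ h
  have h1 := PowerSeries.X_pow_dvd_iff.1 hd.1 k (by omega)
  have h2 := PowerSeries.X_pow_dvd_iff.1 hd.2 k (by omega)
  rw [map_sub, sub_eq_zero] at h1 h2
  exact ⟨h1, h2⟩

theorem formalSol_sub_dvd (n : ℕ) :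
    PowerSeries.X ^ (n + 2) ∣ (formalSol u₁ u₂ c₁ c₂).1 - (formalApprox u₁ u₂ c₁ c₂ n).1 ∧
    PowerSeries.X ^ (n + 2) ∣
      (formalSol u₁ u₂ c₁ c₂).2 - (formalApprox u₁ u₂ c₁ c₂ n).2 := by
  simp only [PowerSeries.X_pow_dvd_iff, map_sub, sub_eq_zero, formalSol, PowerSeries.coeff_mk]
  exact ⟨fun k hk => (coeff_formalApprox_eq u₁ u₂ c₁ c₂ (by omega) (by omega)).1,
    fun k hk => (coeff_formalApprox_eq u₁ u₂ c₁ c₂ (by omega) (by omega)).2⟩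

theorem coeff_zero_formalSol : PowerSeries.coeff 0 (formalSol u₁ u₂ c₁ c₂).1 = 0 ∧
    PowerSeries.coeff 0 (formalSol u₁ u₂ c₁ c₂).2 = 0 := by
  simp [formalSol, formalApprox]

theorem coeff_one_formalSol : PowerSeries.coeff 1 (formalSol u₁ u₂ c₁ c₂).1 = 1 ∧
    PowerSeries.coeff 1 (formalSol u₁ u₂ c₁ c₂).2 = 0 := by
  simp [formalSol, formalApprox, PowerSeries.coeff_monomial, PowerSeries.coeff_X]

theorem X_dvd_formalSol : PowerSeries.X ∣ (formalSol u₁ u₂ c₁ c₂).1 ∧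
    PowerSeries.X ∣ (formalSol u₁ u₂ c₁ c₂).2 := by
  have h := coeff_zero_formalSol u₁ u₂ c₁ c₂
  simp only [PowerSeries.coeff_zero_eq_constantCoeff] at h
  exact ⟨PowerSeries.X_dvd_iff.2 h.1, PowerSeries.X_dvd_iff.2 h.2⟩

/-- The solution agrees with stage `k - 2` modulo `X ^ k`, so the nonlinear coefficient inserted at
the next stage already has its final value. -/
theorem coeff_formalSol {k : ℕ} (hk : 2 ≤ k) :
    PowerSeries.coeff k (formalSol u₁ u₂ c₁ c₂).1
      = u₁ k * nonlinCoeff c₁ (formalSol u₁ u₂ c₁ c₂).1 (formalSol u₁ u₂ c₁ c₂).2 k ∧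
    PowerSeries.coeff k (formalSol u₁ u₂ c₁ c₂).2
      = u₂ k * nonlinCoeff c₂ (formalSol u₁ u₂ c₁ c₂).1 (formalSol u₁ u₂ c₁ c₂).2 k := by
  obtain ⟨n, rfl⟩ : ∃ n, k = n + 2 := ⟨k - 2, by omega⟩
  have h1 := coeff_formalApprox_eq u₁ u₂ c₁ c₂ (m := n + 2) (n := n + 1) (k := n + 2)
    (by omega) (by omega)
  have h2 := coeff_formalApprox_eq_zero u₁ u₂ c₁ c₂ (n := n) (k := n + 2) le_rfl
  have h3 := formalSol_sub_dvd u₁ u₂ c₁ c₂ n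
  have h4 := X_dvd_formalSol u₁ u₂ c₁ c₂
  have h5 := X_dvd_formalApprox u₁ u₂ c₁ c₂ n
  rw [nonlinCoeff_congr c₁ h4.1 h4.2 h5.1 h5.2 h3.1 h3.2,
    nonlinCoeff_congr c₂ h4.1 h4.2 h5.1 h5.2 h3.1 h3.2]
  constructor
  · rw [formalSol, PowerSeries.coeff_mk, h1.1]
    simp only [formalApprox, map_add, h2.1, PowerSeries.coeff_monomial, if_true, zero_add]
  · rw [formalSol, PowerSeries.coeff_mk, h1.2]
    simp only [formalApprox, map_add, h2.2, PowerSeries.coeff_monomial, if_true, zero_add]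

end Formal

/-! ### Holomorphic dependence of the formal coefficients -/

theorem differentiableAt_coeff_mul {P Q : ℂ → PowerSeries ℂ} {z : ℂ}
    (hP : ∀ j, DifferentiableAt ℂ (fun s => PowerSeries.coeff j (P s)) z)
    (hQ : ∀ j, DifferentiableAt ℂ (fun s => PowerSeries.coeff j (Q s)) z) (j : ℕ) :
    DifferentiableAt ℂ (fun s => PowerSeries.coeff j (P s * Q s)) z := by
  simp only [PowerSeries.coeff_mul]
  exact DifferentiableAt.fun_sum fun x _ => (hP x.1).mul (hQ x.2)

theorem differentiableAt_coeff_pow {P : ℂ → PowerSeries ℂ} {z : ℂ}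
    (hP : ∀ j, DifferentiableAt ℂ (fun s => PowerSeries.coeff j (P s)) z) (n j : ℕ) :
    DifferentiableAt ℂ (fun s => PowerSeries.coeff j (P s ^ n)) z := by
  induction n generalizing j with
  | zero => simp
  | succ n ih =>
    simp only [pow_succ]
    exact differentiableAt_coeff_mul ih hP j

theorem differentiableAt_nonlinCoeff {c : ℕ → ℕ → ℂ → ℂ} {P Q : ℂ → PowerSeries ℂ} {z : ℂ}
    (hc : ∀ p q, DifferentiableAt ℂ (c p q) z)
    (hP : ∀ j, DifferentiableAt ℂ (fun s => PowerSeries.coeff j (P s)) z)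
    (hQ : ∀ j, DifferentiableAt ℂ (fun s => PowerSeries.coeff j (Q s)) z) (k : ℕ) :
    DifferentiableAt ℂ (fun s => nonlinCoeff (fun p q => c p q s) (P s) (Q s) k) z :=
  DifferentiableAt.fun_sum fun x _ => (hc x.1 x.2).mul
    (differentiableAt_coeff_mul (differentiableAt_coeff_pow hP x.1)
      (differentiableAt_coeff_pow hQ x.2) k)

/-- Stage `n` involves the factors `u₁ k`, `u₂ k` only for `2 ≤ k ≤ n + 1`. Restricting the
hypotheses to these is essential: off the ray, later divisors may vanish. -/
theorem differentiableAt_coeff_formalApprox {u₁ u₂ : ℕ → ℂ → ℂ} {c₁ c₂ : ℕ → ℕ → ℂ → ℂ} {z : ℂ}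
    (hc₁ : ∀ p q, DifferentiableAt ℂ (c₁ p q) z) (hc₂ : ∀ p q, DifferentiableAt ℂ (c₂ p q) z)
    {n : ℕ} (hu₁ : ∀ k, 2 ≤ k → k ≤ n + 1 → DifferentiableAt ℂ (u₁ k) z)
    (hu₂ : ∀ k, 2 ≤ k → k ≤ n + 1 → DifferentiableAt ℂ (u₂ k) z) (j : ℕ) :
    DifferentiableAt ℂ (fun s => PowerSeries.coeff j (formalApprox (fun k => u₁ k s)
      (fun k => u₂ k s) (fun p q => c₁ p q s) (fun p q => c₂ p q s) n).1) z ∧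
    DifferentiableAt ℂ (fun s => PowerSeries.coeff j (formalApprox (fun k => u₁ k s)
      (fun k => u₂ k s) (fun p q => c₁ p q s) (fun p q => c₂ p q s) n).2) z := by
  induction n generalizing j with
  | zero => simp [formalApprox]
  | succ n ih =>
    have ih' := ih (fun k h2 hk => hu₁ k h2 (by omega)) (fun k h2 hk => hu₂ k h2 (by omega))
    simp only [formalApprox, map_add, PowerSeries.coeff_monomial]
    constructor
    · refine (ih' j).1.add ?_
      split_ifs
      · exact (hu₁ _ (by omega) le_rfl).mul
          (differentiableAt_nonlinCoeff hc₁ (fun j => (ih' j).1) (fun j => (ih' j).2) _)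
      · exact differentiableAt_const _
    · refine (ih' j).2.add ?_
      split_ifs
      · exact (hu₂ _ (by omega) le_rfl).mul
          (differentiableAt_nonlinCoeff hc₂ (fun j => (ih' j).1) (fun j => (ih' j).2) _)
      · exact differentiableAt_const _

/-! ### Weighted norms and the majorant estimate -/

theorem sum_antidiagonal_le_sum_mul {m n : ℕ} {f g : ℕ → ℝ} (hf : ∀ i, 0 ≤ f i)
    (hg : ∀ i, 0 ≤ g i) (h : ∀ i j, i + j < m → f i * g j ≠ 0 → i < n ∧ j < n) :
    ∑ k ∈ Finset.range m, ∑ x ∈ Finset.HasAntidiagonal.antidiagonal k, f x.1 * g x.2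
      ≤ (∑ i ∈ Finset.range n, f i) * ∑ j ∈ Finset.range n, g j := by
  rw [Finset.sum_mul_sum, ← Finset.sum_product', ← Finset.sum_biUnion,
    ← Finset.sum_filter_ne_zero]
  · refine Finset.sum_le_sum_of_subset_of_nonneg (fun x hx => ?_) fun x _ _ =>
      mul_nonneg (hf _) (hg _)
    simp only [Finset.mem_filter, Finset.mem_biUnion, Finset.mem_range,
      Finset.HasAntidiagonal.mem_antidiagonal, Finset.mem_product] at hx ⊢
    obtain ⟨⟨k, hk, rfl⟩, hx⟩ := hx
    exact h _ _ hk hx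
  · intro a _ b _ hab
    rw [Function.onFun, Finset.disjoint_left]
    intro x ha hb
    exact hab ((Finset.HasAntidiagonal.mem_antidiagonal.1 ha).symm.trans (Finset.HasAntidiagonal.mem_antidiagonal.1 hb))

/-- The weighted `ℓ¹` norm of the truncation of a power series at order `n`. -/
noncomputable def weightedNorm (v : ℕ → ℝ) (n : ℕ) (P : PowerSeries ℂ) : ℝ :=
  ∑ k ∈ Finset.range (n + 1), ‖PowerSeries.coeff k P‖ * v k

theorem weightedNorm_nonneg {v : ℕ → ℝ} (hv : ∀ k, 0 ≤ v k) (n : ℕ) (P : PowerSeries ℂ) :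
    0 ≤ weightedNorm v n P :=
  Finset.sum_nonneg fun k _ => mul_nonneg (norm_nonneg _) (hv k)

theorem norm_coeff_mul_le {v w : ℕ → ℝ} (P Q : PowerSeries ℂ) (k : ℕ) (hw : 0 ≤ w k)
    (h : ∀ i j, i + j = k → PowerSeries.coeff i P ≠ 0 → PowerSeries.coeff j Q ≠ 0 →
      w k ≤ v i * v j) :
    ‖PowerSeries.coeff k (P * Q)‖ * w k ≤ ∑ x ∈ Finset.HasAntidiagonal.antidiagonal k,
      (‖PowerSeries.coeff x.1 P‖ * v x.1) * (‖PowerSeries.coeff x.2 Q‖ * v x.2) := by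
  rw [PowerSeries.coeff_mul]
  refine (mul_le_mul_of_nonneg_right (norm_sum_le _ _) hw).trans ?_
  rw [Finset.sum_mul]
  refine Finset.sum_le_sum fun x hx => ?_
  rw [norm_mul]
  by_cases hP : PowerSeries.coeff x.1 P = 0
  · simp [hP]
  by_cases hQ : PowerSeries.coeff x.2 Q = 0
  · simp [hQ]
  have := h _ _ (Finset.HasAntidiagonal.mem_antidiagonal.1 hx) hP hQ
  calc ‖PowerSeries.coeff x.1 P‖ * ‖PowerSeries.coeff x.2 Q‖ * w k
      ≤ ‖PowerSeries.coeff x.1 P‖ * ‖PowerSeries.coeff x.2 Q‖ * (v x.1 * v x.2) := by gcongr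
    _ = _ := by ring

theorem weightedNorm_mul_le {v : ℕ → ℝ} (hv : ∀ k, 0 ≤ v k)
    (hmul : ∀ i j, v (i + j) ≤ v i * v j) (n : ℕ) (P Q : PowerSeries ℂ) :
    weightedNorm v n (P * Q) ≤ weightedNorm v n P * weightedNorm v n Q := by
  refine (Finset.sum_le_sum fun k _ => norm_coeff_mul_le (v := v) P Q k (hv k)
    fun i j hij _ _ => hij ▸ hmul i j).trans ?_
  exact sum_antidiagonal_le_sum_mul (m := n + 1) (n := n + 1)
    (f := fun i => ‖PowerSeries.coeff i P‖ * v i) (g := fun i => ‖PowerSeries.coeff i Q‖ * v i)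
    (fun i => mul_nonneg (norm_nonneg _) (hv i))
    (fun i => mul_nonneg (norm_nonneg _) (hv i)) fun i j h _ => ⟨by omega, by omega⟩

theorem weightedNorm_pow_mul_pow_le {v : ℕ → ℝ} (hv : ∀ k, 0 ≤ v k) (hv0 : v 0 = 1)
    (hmul : ∀ i j, v (i + j) ≤ v i * v j) (n : ℕ) {P Q : PowerSeries ℂ} {S : ℝ}
    (hP : weightedNorm v n P ≤ S) (hQ : weightedNorm v n Q ≤ S) (p q : ℕ) :
    weightedNorm v n (P ^ p * Q ^ q) ≤ S ^ (p + q) := by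
  have hpow : ∀ {P : PowerSeries ℂ}, weightedNorm v n P ≤ S → ∀ p,
      weightedNorm v n (P ^ p) ≤ S ^ p := by
    intro P hP p
    induction p with
    | zero =>
      rw [weightedNorm, Finset.sum_range_succ', Finset.sum_eq_zero]
      · simp [hv0]
      · intro k _
        simp [PowerSeries.coeff_one]
    | succ p ih =>
      rw [pow_succ, pow_succ]
      exact (weightedNorm_mul_le hv hmul n _ _).trans (mul_le_mul ih hP
        (weightedNorm_nonneg hv n _) ((weightedNorm_nonneg hv n _).trans ih))
  rw [pow_add]
  exact (weightedNorm_mul_le hv hmul n _ _).trans (mul_le_mul (hpow hP p) (hpow hQ q)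
    (weightedNorm_nonneg hv n _) ((weightedNorm_nonneg hv n _).trans (hpow hP p)))

/-- With both factors of positive order, the coefficient of the product at `n + 1` uses only
coefficients up to `n`. This gain of one order drives the induction on truncations, and it is why
`hmul` is needed only for `i, j ≥ 1`. -/
theorem weighted_coeff_mul_le {v w : ℕ → ℝ} (hv : ∀ k, 0 ≤ v k) (hw : ∀ k, 0 ≤ w k)
    (hmul : ∀ i j, 1 ≤ i → 1 ≤ j → w (i + j) ≤ v i * v j) (n : ℕ) {P Q : PowerSeries ℂ}
    (hP : PowerSeries.X ∣ P) (hQ : PowerSeries.X ∣ Q) :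
    ∑ k ∈ Finset.range (n + 2), ‖PowerSeries.coeff k (P * Q)‖ * w k
      ≤ weightedNorm v n P * weightedNorm v n Q := by
  have h0 : ∀ {P : PowerSeries ℂ}, PowerSeries.X ∣ P → ∀ i, PowerSeries.coeff i P ≠ 0 → 1 ≤ i := by
    intro P hP i hi
    by_contra h
    obtain rfl : i = 0 := by omega
    rw [PowerSeries.coeff_zero_eq_constantCoeff] at hi
    exact hi (PowerSeries.X_dvd_iff.1 hP)
  refine (Finset.sum_le_sum fun k _ => norm_coeff_mul_le (v := v) P Q k (hw k)
    fun i j hij hi hj => hij ▸ hmul i j (h0 hP i hi) (h0 hQ j hj)).trans ?_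
  refine sum_antidiagonal_le_sum_mul (m := n + 2) (n := n + 1)
    (f := fun i => ‖PowerSeries.coeff i P‖ * v i) (g := fun i => ‖PowerSeries.coeff i Q‖ * v i)
    (fun i => mul_nonneg (norm_nonneg _) (hv i))
    (fun i => mul_nonneg (norm_nonneg _) (hv i)) fun i j h hne => ?_
  have h1 := h0 hP i fun h => hne (by simp [h])
  have h2 := h0 hQ j fun h => hne (by simp [h])
  omega

theorem sum_quarter_pow_le (n : ℕ) : ∑ i ∈ Finset.range n, (1 / 4 : ℝ) ^ i ≤ 4 / 3 := by
  have h := Summable.sum_le_tsum (Finset.range n) (fun i _ => by positivity)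
    (summable_geometric_of_lt_one (by norm_num) (by norm_num : (1 / 4 : ℝ) < 1))
  rw [tsum_geometric_of_lt_one (by norm_num) (by norm_num)] at h
  linarith

/-- Pull out `s ^ 2 ≤ t ^ 2` and dominate the rest by a double geometric series of ratio `1 / 4`;
the constant is `16 * (4 / 3) ^ 2 ≤ 32`. -/
theorem sum_pow_add_le {s t : ℝ} (hs : 0 ≤ s) (hst : s ≤ t) (ht : t ≤ 1 / 4) (n : ℕ) :
    ∑ x ∈ (Finset.range n ×ˢ Finset.range n).filter (fun x => 2 ≤ x.1 + x.2), s ^ (x.1 + x.2)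
      ≤ 32 * t ^ 2 := by
  calc ∑ x ∈ (Finset.range n ×ˢ Finset.range n).filter (fun x => 2 ≤ x.1 + x.2),
        s ^ (x.1 + x.2)
      ≤ ∑ x ∈ (Finset.range n ×ˢ Finset.range n).filter (fun x => 2 ≤ x.1 + x.2),
        16 * t ^ 2 * ((1 / 4) ^ x.1 * (1 / 4) ^ x.2) := by
        refine Finset.sum_le_sum fun x hx => ?_
        obtain ⟨m, hm⟩ := Nat.exists_eq_add_of_le (Finset.mem_filter.1 hx).2
        have h1 : s ^ 2 ≤ t ^ 2 := pow_le_pow_left₀ hs hst 2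
        have h2 : s ^ m ≤ (1 / 4) ^ m := pow_le_pow_left₀ hs (hst.trans ht) m
        rw [← pow_add, hm, pow_add, pow_add]
        calc s ^ 2 * s ^ m ≤ t ^ 2 * (1 / 4) ^ m := by gcongr
          _ = _ := by ring
    _ ≤ ∑ x ∈ Finset.range n ×ˢ Finset.range n, 16 * t ^ 2 * ((1 / 4) ^ x.1 * (1 / 4) ^ x.2) :=
        Finset.sum_le_sum_of_subset_of_nonneg (Finset.filter_subset _ _)
          fun _ _ _ => by positivity
    _ = 16 * t ^ 2 * ((∑ i ∈ Finset.range n, (1 / 4 : ℝ) ^ i) *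
          ∑ j ∈ Finset.range n, (1 / 4 : ℝ) ^ j) := by
        rw [Finset.sum_mul_sum, ← Finset.sum_product', Finset.mul_sum]
    _ ≤ 16 * t ^ 2 * (4 / 3 * (4 / 3)) := by
        have := sum_quarter_pow_le n
        have h0 : 0 ≤ ∑ i ∈ Finset.range n, (1 / 4 : ℝ) ^ i :=
          Finset.sum_nonneg fun i _ => by positivity
        gcongr
    _ ≤ 32 * t ^ 2 := by nlinarith [sq_nonneg t]

theorem norm_nonlinCoeff_le {c : ℕ → ℕ → ℂ} {M R : ℝ}
    (hc : ∀ p q, ‖c p q‖ ≤ M * R⁻¹ ^ (p + q)) (hM : 0 ≤ M) (hR : 0 < R)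
    (P Q : PowerSeries ℂ) {k n : ℕ} (hk : k ≤ n) :
    ‖nonlinCoeff c P Q k‖ ≤
      ∑ x ∈ (Finset.range (n + 1) ×ˢ Finset.range (n + 1)).filter (fun x => 2 ≤ x.1 + x.2),
        M * R⁻¹ ^ (x.1 + x.2) * ‖PowerSeries.coeff k (P ^ x.1 * Q ^ x.2)‖ := by
  refine (norm_sum_le _ _).trans ((Finset.sum_le_sum fun x _ => ?_).trans
    (Finset.sum_le_sum_of_subset_of_nonneg ?_ fun x _ _ => by positivity))
  · rw [norm_mul]
    exact mul_le_mul_of_nonneg_right (hc _ _) (norm_nonneg _)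
  · refine Finset.filter_subset_filter _ (Finset.product_subset_product ?_ ?_) <;>
      exact Finset.range_subset_range.2 (by omega)

/-- Siegel's majorant estimate for the formal solution of the invariance equation. -/
theorem norm_coeff_le_of_recursion {u₁ u₂ : ℕ → ℂ} {c₁ c₂ : ℕ → ℕ → ℂ} {P Q : PowerSeries ℂ}
    {η E : ℕ → ℝ} {A M R ρ : ℝ} {K : ℕ} (hη0 : η 0 = 1) (hη1 : η 1 = 1) (hηpos : ∀ k, 0 < η k)
    (hE : ∀ k, 1 ≤ E k)
    (hη : ∀ i j, 1 ≤ i → 1 ≤ j → E (i + j) * (η i * η j) ≤ η (i + j))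
    (hA : 0 ≤ A) (hM : 0 ≤ M) (hR : 0 < R)
    (hu₁ : ∀ k, 2 ≤ k → k ≤ K → ‖u₁ k‖ ≤ A * E k)
    (hu₂ : ∀ k, 2 ≤ k → k ≤ K → ‖u₂ k‖ ≤ A * E k)
    (hc₁ : ∀ p q, ‖c₁ p q‖ ≤ M * R⁻¹ ^ (p + q)) (hc₂ : ∀ p q, ‖c₂ p q‖ ≤ M * R⁻¹ ^ (p + q))
    (hP0 : PowerSeries.coeff 0 P = 0) (hQ0 : PowerSeries.coeff 0 Q = 0)
    (hP1 : PowerSeries.coeff 1 P = 1) (hQ1 : PowerSeries.coeff 1 Q = 0)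
    (hP : ∀ k, 2 ≤ k → PowerSeries.coeff k P = u₁ k * nonlinCoeff c₁ P Q k)
    (hQ : ∀ k, 2 ≤ k → PowerSeries.coeff k Q = u₂ k * nonlinCoeff c₂ P Q k)
    (hρ : 0 < ρ) (hρR : 8 * ρ ≤ R) (hρA : 256 * A * M * ρ ≤ R ^ 2) {k : ℕ} (hk : k ≤ K) :
    ‖PowerSeries.coeff k P‖ ≤ 2 * ρ * (η k * ρ⁻¹ ^ k) ∧
      ‖PowerSeries.coeff k Q‖ ≤ 2 * ρ * (η k * ρ⁻¹ ^ k) := by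
  -- With these weights the hypothesis on `η` becomes `E (i + j) * v (i + j) ≤ v i * v j`: a product
  -- of two series of positive order absorbs the divisor factor.
  set v : ℕ → ℝ := fun k => ρ ^ k * (η k)⁻¹ with hv
  have hvpos : ∀ k, 0 < v k := fun k => mul_pos (by positivity) (inv_pos.2 (hηpos k))
  have hv0 : v 0 = 1 := by simp [hv, hη0]
  have hv1 : v 1 = ρ := by simp [hv, hη1]
  have hEv : ∀ i j, 1 ≤ i → 1 ≤ j → E (i + j) * v (i + j) ≤ v i * v j := by
    intro i j hi hj
    have h1 := hη i j hi hj
    have h2 := hηpos i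
    have h3 := hηpos j
    have h4 := hηpos (i + j)
    have h5 : E (i + j) * (η (i + j))⁻¹ ≤ (η i)⁻¹ * (η j)⁻¹ := by
      rw [← mul_inv, ← div_eq_mul_inv, ← one_div, div_le_div_iff₀ h4 (by positivity)]
      linarith
    calc E (i + j) * v (i + j) = ρ ^ (i + j) * (E (i + j) * (η (i + j))⁻¹) := by
          simp only [hv]; ring
      _ ≤ ρ ^ (i + j) * ((η i)⁻¹ * (η j)⁻¹) := by gcongr
      _ = v i * v j := by simp only [hv]; ring
  have hmul : ∀ i j, v (i + j) ≤ v i * v j := by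
    intro i j
    rcases Nat.eq_zero_or_pos i with rfl | hi
    · simp [hv0]
    rcases Nat.eq_zero_or_pos j with rfl | hj
    · simp [hv0]
    exact (le_mul_of_one_le_left (hvpos _).le (hE _)).trans (hEv i j hi hj)
  have hXP : PowerSeries.X ∣ P :=
    PowerSeries.X_dvd_iff.2 (by rwa [PowerSeries.coeff_zero_eq_constantCoeff] at hP0)
  have hXQ : PowerSeries.X ∣ Q :=
    PowerSeries.X_dvd_iff.2 (by rwa [PowerSeries.coeff_zero_eq_constantCoeff] at hQ0)
  -- The linear term contributes `v 1 = ρ`, and the nonlinear terms, quadratic in the previous norm,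
  -- contribute at most another `ρ`, so the bound `2 * ρ` reproduces itself.
  have main : ∀ n, n ≤ K → weightedNorm v n P + weightedNorm v n Q ≤ 2 * ρ := by
    intro n
    induction n with
    | zero =>
      intro _
      simp only [weightedNorm, zero_add, Finset.sum_range_one, hP0, hQ0, norm_zero, zero_mul]
      linarith
    | succ n ih =>
      intro hn
      set S := weightedNorm v n P + weightedNorm v n Q with hS
      have hSle : S ≤ 2 * ρ := ih (by omega)
      have hNP := weightedNorm_nonneg (fun k => (hvpos k).le) n P
      have hNQ := weightedNorm_nonneg (fun k => (hvpos k).le) n Q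
      have hSP : weightedNorm v n P ≤ S := by linarith
      have hSQ : weightedNorm v n Q ≤ S := by linarith
      have hS0 : 0 ≤ S := by linarith
      set I := (Finset.range (n + 1 + 1) ×ˢ Finset.range (n + 1 + 1)).filter
        (fun x => 2 ≤ x.1 + x.2) with hI
      have hterm : ∀ x ∈ I, ∑ k ∈ Finset.range (n + 2),
          ‖PowerSeries.coeff k (P ^ x.1 * Q ^ x.2)‖ * (E k * v k) ≤ S ^ (x.1 + x.2) := by
        intro x hx
        obtain ⟨p', q', h1, h2, h3⟩ := exists_pow_mul_pow_split (Finset.mem_filter.1 hx).2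
        have hB := weightedNorm_pow_mul_pow_le (fun k => (hvpos k).le) hv0 hmul n hSP hSQ p' q'
        have hXB := X_dvd_pow_mul_pow hXP hXQ h1
        have hw : ∀ k, 0 ≤ E k * v k := fun k =>
          mul_nonneg (zero_le_one.trans (hE k)) (hvpos k).le
        rw [← h2, pow_succ']
        rcases h3 with h3 | h3 <;> rw [h3]
        · exact (weighted_coeff_mul_le (fun k => (hvpos k).le) hw hEv n hXP hXB).trans
            (mul_le_mul hSP hB (weightedNorm_nonneg (fun k => (hvpos k).le) n _) hS0)
        · exact (weighted_coeff_mul_le (fun k => (hvpos k).le) hw hEv n hXQ hXB).trans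
            (mul_le_mul hSQ hB (weightedNorm_nonneg (fun k => (hvpos k).le) n _) hS0)
      set T : ℕ → ℝ := fun k => ∑ x ∈ I,
        M * R⁻¹ ^ (x.1 + x.2) * ‖PowerSeries.coeff k (P ^ x.1 * Q ^ x.2)‖ with hT
      have hT0 : ∀ k, 0 ≤ T k := fun k => Finset.sum_nonneg fun x _ => by positivity
      have hpt : ∀ k ∈ Finset.range (n + 2),
          (‖PowerSeries.coeff k P‖ + ‖PowerSeries.coeff k Q‖) * v k
            ≤ (if k = 1 then ρ else 0) + 2 * A * (T k * (E k * v k)) := by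
        intro k hk
        have hk' : k ≤ n + 1 := by have := Finset.mem_range.1 hk; omega
        have hnn : 0 ≤ 2 * A * (T k * (E k * v k)) := by
          have := hT0 k
          have := hvpos k
          have := hE k
          positivity
        rcases Nat.lt_or_ge k 2 with h2 | h2
        · interval_cases k
          · simpa [hP0, hQ0] using hnn
          · simpa [hP1, hQ1, hv1] using hnn
        · rw [if_neg (by omega), zero_add, hP k h2, hQ k h2, norm_mul, norm_mul]
          have e1 := norm_nonlinCoeff_le hc₁ hM hR P Q hk'
          have e2 := norm_nonlinCoeff_le hc₂ hM hR P Q hk'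
          have f1 := mul_le_mul (hu₁ k h2 (by omega)) e1 (norm_nonneg _)
            (mul_nonneg hA (zero_le_one.trans (hE k)))
          have f2 := mul_le_mul (hu₂ k h2 (by omega)) e2 (norm_nonneg _)
            (mul_nonneg hA (zero_le_one.trans (hE k)))
          calc _ ≤ (A * E k * T k + A * E k * T k) * v k :=
                mul_le_mul_of_nonneg_right (add_le_add f1 f2) (hvpos k).le
            _ = _ := by ring
      have hsum : ∑ k ∈ Finset.range (n + 2), T k * (E k * v k) ≤ M * (32 * (2 * ρ / R) ^ 2) := by
        calc ∑ k ∈ Finset.range (n + 2), T k * (E k * v k)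
            = ∑ x ∈ I, M * R⁻¹ ^ (x.1 + x.2) * ∑ k ∈ Finset.range (n + 2),
                ‖PowerSeries.coeff k (P ^ x.1 * Q ^ x.2)‖ * (E k * v k) := by
              simp only [hT, Finset.sum_mul, Finset.mul_sum]
              rw [Finset.sum_comm]
              exact Finset.sum_congr rfl fun x _ => Finset.sum_congr rfl fun k _ => by ring
          _ ≤ ∑ x ∈ I, M * R⁻¹ ^ (x.1 + x.2) * S ^ (x.1 + x.2) :=
              Finset.sum_le_sum fun x hx =>
                mul_le_mul_of_nonneg_left (hterm x hx) (by positivity)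
          _ = M * ∑ x ∈ I, (R⁻¹ * S) ^ (x.1 + x.2) := by
              rw [Finset.mul_sum]
              exact Finset.sum_congr rfl fun x _ => by rw [mul_pow]; ring
          _ ≤ M * (32 * (2 * ρ / R) ^ 2) := by
              refine mul_le_mul_of_nonneg_left (sum_pow_add_le (by positivity) ?_ ?_ _) hM
              · rw [div_eq_inv_mul]; gcongr
              · rw [div_le_iff₀ hR]; linarith
      have hfin : 2 * A * (M * (32 * (2 * ρ / R) ^ 2)) ≤ ρ := by
        have : 2 * A * (M * (32 * (2 * ρ / R) ^ 2)) = (256 * A * M * ρ) * ρ / R ^ 2 := by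
          field_simp; ring
        rw [this, div_le_iff₀ (by positivity)]
        nlinarith
      calc weightedNorm v (n + 1) P + weightedNorm v (n + 1) Q
          = ∑ k ∈ Finset.range (n + 2),
              (‖PowerSeries.coeff k P‖ + ‖PowerSeries.coeff k Q‖) * v k := by
            simp only [weightedNorm, ← Finset.sum_add_distrib, add_mul]
        _ ≤ ∑ k ∈ Finset.range (n + 2),
              ((if k = 1 then ρ else 0) + 2 * A * (T k * (E k * v k))) :=
            Finset.sum_le_sum hpt
        _ = ρ + 2 * A * ∑ k ∈ Finset.range (n + 2), T k * (E k * v k) := by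
            rw [Finset.sum_add_distrib, ← Finset.mul_sum, Finset.sum_ite_eq',
              if_pos (by simp)]
        _ ≤ 2 * ρ := by
            have := mul_le_mul_of_nonneg_left hsum (by positivity : 0 ≤ 2 * A)
            linarith
  have hle : ∀ U : PowerSeries ℂ, weightedNorm v k U ≤ 2 * ρ →
      ‖PowerSeries.coeff k U‖ ≤ 2 * ρ * (η k * ρ⁻¹ ^ k) := by
    intro U hU
    have h1 : ‖PowerSeries.coeff k U‖ * v k ≤ 2 * ρ :=
      (Finset.single_le_sum (f := fun k => ‖PowerSeries.coeff k U‖ * v k)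
        (fun i _ => mul_nonneg (norm_nonneg _) (hvpos i).le) (Finset.self_mem_range_succ k)).trans
        hU
    have h2 : η k * ρ⁻¹ ^ k = (v k)⁻¹ := by simp [hv]
    rw [h2, ← div_eq_mul_inv, le_div_iff₀ (hvpos k)]
    exact h1
  have h1 := main k hk
  have h2 := weightedNorm_nonneg (fun k => (hvpos k).le) k P
  have h3 := weightedNorm_nonneg (fun k => (hvpos k).le) k Q
  exact ⟨hle P (by linarith), hle Q (by linarith)⟩

/-! ### Cauchy integrals and Taylor expansion with a parameter -/

theorem continuous_section {E : Type*} [TopologicalSpace E] {g : ℂ → ℝ → E} {U : Set ℂ}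
    (hg : ContinuousOn (Function.uncurry g) (U ×ˢ Set.univ)) {z : ℂ} (hz : z ∈ U) :
    Continuous (g z) := by
  rw [← continuousOn_univ]
  exact hg.comp (f := fun θ : ℝ => (z, θ)) (by fun_prop) fun θ _ => ⟨hz, trivial⟩

section Taylor

variable {E : Type*} [NormedAddCommGroup E] [NormedSpace ℂ E]

/-- Holomorphic dependence of an integral on a parameter. -/
theorem differentiableOn_intervalIntegral {U : Set ℂ} (hU : IsOpen U) {g : ℂ → ℝ → E} (a b : ℝ)
    (hg : ContinuousOn (Function.uncurry g) (U ×ˢ Set.univ))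
    (hd : ∀ θ, DifferentiableOn ℂ (fun z => g z θ) U) :
    DifferentiableOn ℂ (fun z => ∫ θ in a..b, g z θ) U := by
  intro z₀ hz₀
  obtain ⟨ε, hε, hεU⟩ := Metric.nhds_basis_closedBall.mem_iff.1 (hU.mem_nhds hz₀)
  obtain ⟨M, hM⟩ := ((isCompact_closedBall z₀ ε).prod
    (isCompact_uIcc (a := a) (b := b))).exists_bound_of_continuousOn
    (hg.mono (Set.prod_mono hεU (Set.subset_univ _)))
  have hda : ∀ θ, ∀ z ∈ U, HasDerivAt (fun z => g z θ) (deriv (fun z => g z θ) z) z :=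
    fun θ z hz => ((hd θ).differentiableAt (hU.mem_nhds hz)).hasDerivAt
  have hcont : ∀ z ∈ U, Continuous (g z) := fun z hz => continuous_section hg hz
  refine (intervalIntegral.hasDerivAt_integral_of_dominated_loc_of_deriv_le
    (F' := fun z θ => deriv (fun z => g z θ) z) (bound := fun _ => M / (ε / 2))
    (Metric.ball_mem_nhds z₀ (half_pos hε)) ?_ ?_ ?_ ?_ ?_ ?_).2.differentiableAt.differentiableWithinAt
  · filter_upwards [hU.mem_nhds hz₀] with z hz
    exact (hcont z hz).aestronglyMeasurable
  · exact (hcont z₀ hz₀).intervalIntegrable _ _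
  -- Measurability of the derivative in `θ`: it is a pointwise limit of difference quotients along
  -- `z₀ + ε / (n + 1)`.
  · have hn : ∀ n : ℕ, z₀ + ((ε / (n + 1) : ℝ) : ℂ) ∈ U := fun n => hεU (by
      rw [Metric.mem_closedBall, dist_eq_norm, add_sub_cancel_left, Complex.norm_real,
        Real.norm_of_nonneg (by positivity)]
      exact div_le_self hε.le (by linarith [(Nat.cast_nonneg n : (0 : ℝ) ≤ n)]))
    refine aestronglyMeasurable_of_tendsto_ae atTop (f := fun (n : ℕ) θ =>
      ((ε / (n + 1) : ℝ) : ℂ)⁻¹ • (g (z₀ + ((ε / (n + 1) : ℝ) : ℂ)) θ - g z₀ θ))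
      (fun n => (((hcont _ (hn n)).sub (hcont _ hz₀)).const_smul _).aestronglyMeasurable)
      (Eventually.of_forall fun θ => ?_)
    refine (hasDerivAt_iff_tendsto_slope_zero.1 (hda θ z₀ hz₀)).comp
      (tendsto_nhdsWithin_iff.2 ⟨?_, Eventually.of_forall fun n => ?_⟩)
    · have h : Tendsto (fun n : ℕ => ε / ((n : ℝ) + 1)) atTop (𝓝 0) :=
        tendsto_const_nhds.div_atTop (tendsto_natCast_atTop_atTop.atTop_add tendsto_const_nhds)
      have := (Complex.continuous_ofReal.tendsto 0).comp h
      rwa [Complex.ofReal_zero] at this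
    · have : (ε / ((n : ℝ) + 1)) ≠ 0 := by positivity
      exact Complex.ofReal_ne_zero.2 this
  · refine Eventually.of_forall fun θ hθ z hz => ?_
    have hsub : Metric.closedBall z (ε / 2) ⊆ Metric.closedBall z₀ ε :=
      Metric.closedBall_subset_closedBall' (by
        have := Metric.mem_ball.1 hz
        linarith)
    refine Complex.norm_deriv_le_of_forall_mem_sphere_norm_le (half_pos hε)
      ((hd θ).diffContOnCl_ball (hsub.trans hεU)) fun w hw => ?_
    exact hM (w, θ) ⟨hsub (Metric.sphere_subset_closedBall hw), Set.uIoc_subset_uIcc hθ⟩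
  · exact intervalIntegrable_const
  · refine Eventually.of_forall fun θ _ z hz => hda θ z (hεU ?_)
    exact Metric.ball_subset_closedBall (Metric.ball_subset_ball (half_le_self hε.le) hz)

theorem continuousOn_intervalIntegral {X : Type*} [TopologicalSpace X] {U : Set X} {g : X → ℝ → E}
    (a b : ℝ) (hg : ContinuousOn (Function.uncurry g) (U ×ˢ Set.univ)) :
    ContinuousOn (fun x => ∫ θ in a..b, g x θ) U := by
  rw [continuousOn_iff_continuous_domRestrict]
  have : Continuous (Function.uncurry fun (x : U) θ => g x θ) := by
    rw [← continuousOn_univ]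
    exact hg.comp (f := fun p : U × ℝ => ((p.1 : X), p.2)) (by fun_prop)
      fun p _ => ⟨p.1.2, trivial⟩
  exact intervalIntegral.continuous_parametric_intervalIntegral_of_continuous' this a b

/-- The `n`-th Taylor coefficient at `0` of `G`, as an integral over the circle of radius `R`. -/
noncomputable def cauchyCoeff (R : ℝ) (n : ℕ) (G : ℂ → E) : E :=
  (2 * (Real.pi : ℂ) * Complex.I)⁻¹ • ∮ z in C(0, R), z⁻¹ ^ (n + 1) • G z

theorem hasSum_cauchyCoeff [CompleteSpace E] {R : ℝ} (hR : 0 < R) {G : ℂ → E}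
    (hG : DiffContOnCl ℂ G (Metric.ball 0 R)) {w : ℂ} (hw : ‖w‖ < R) :
    HasSum (fun n => w ^ n • cauchyCoeff R n G) (G w) := by
  have hc : CircleIntegrable G 0 R := by
    refine ContinuousOn.circleIntegrable hR.le (hG.continuousOn.mono ?_)
    rw [closure_ball _ hR.ne']
    exact Metric.sphere_subset_closedBall
  have h := hasSum_cauchyPowerSeries_integral hc hw
  rw [zero_add, hG.two_pi_i_inv_smul_circleIntegral_sub_inv_smul (by simpa using hw)] at h
  refine h.congr_fun ?_
  intro n
  rw [cauchyPowerSeries_apply, cauchyCoeff, smul_comm, ← circleIntegral.integral_smul]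
  congr 2
  ext z
  rw [sub_zero, div_eq_mul_inv, mul_pow, pow_succ, smul_smul, smul_smul, mul_assoc]

theorem norm_cauchyCoeff_le {R : ℝ} (hR : 0 < R) {G : ℂ → E} {M : ℝ}
    (hG : ∀ z ∈ Metric.sphere (0 : ℂ) R, ‖G z‖ ≤ M) (n : ℕ) :
    ‖cauchyCoeff R n G‖ ≤ M * R⁻¹ ^ n := by
  refine (circleIntegral.norm_two_pi_i_inv_smul_integral_le_of_norm_le_const (C := R⁻¹ ^ (n + 1) * M)
    hR.le fun z hz => ?_).trans_eq ?_
  · rw [norm_smul, norm_pow, norm_inv, mem_sphere_zero_iff_norm.1 hz]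
    exact mul_le_mul_of_nonneg_left (hG z hz) (by positivity)
  · rw [pow_succ]
    field_simp

theorem continuousOn_cauchy_integrand {X : Type*} [TopologicalSpace X] {U : Set X} {R : ℝ}
    (hR : 0 < R) {G : X → ℂ → E}
    (hG : ContinuousOn (Function.uncurry G) (U ×ˢ Metric.sphere 0 R)) (n : ℕ) :
    ContinuousOn (Function.uncurry fun (x : X) (θ : ℝ) => deriv (circleMap 0 R) θ •
      ((circleMap 0 R θ)⁻¹ ^ (n + 1) • G x (circleMap 0 R θ))) (U ×ˢ Set.univ) := by
  have h1 : ContinuousOn (fun p : X × ℝ => G p.1 (circleMap 0 R p.2)) (U ×ˢ Set.univ) :=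
    hG.comp (f := fun p : X × ℝ => (p.1, circleMap 0 R p.2))
      (continuous_fst.prodMk ((continuous_circleMap 0 R).comp continuous_snd)).continuousOn
      fun p hp => ⟨hp.1, circleMap_mem_sphere 0 hR.le _⟩
  have h2 : Continuous fun p : X × ℝ => (circleMap 0 R p.2)⁻¹ ^ (n + 1) :=
    (((continuous_circleMap 0 R).comp continuous_snd).inv₀
      fun p => circleMap_ne_center hR.ne').pow _
  have h3 : Continuous fun p : X × ℝ => deriv (circleMap 0 R) p.2 := by
    simp only [deriv_circleMap]
    exact ((continuous_circleMap 0 R).comp continuous_snd).mul continuous_const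
  exact h3.continuousOn.smul (h2.continuousOn.smul h1)

theorem differentiableOn_cauchyCoeff {U : Set ℂ} (hU : IsOpen U) {R : ℝ} (hR : 0 < R)
    {G : ℂ → ℂ → E} (hG : ContinuousOn (Function.uncurry G) (U ×ˢ Metric.sphere 0 R))
    (hd : ∀ ζ ∈ Metric.sphere (0 : ℂ) R, DifferentiableOn ℂ (fun z => G z ζ) U) (n : ℕ) :
    DifferentiableOn ℂ (fun z => cauchyCoeff R n (G z)) U := by
  refine (differentiableOn_intervalIntegral hU _ _ (continuousOn_cauchy_integrand hR hG n)
    fun θ => ?_).const_smul _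
  exact ((hd _ (circleMap_mem_sphere 0 hR.le θ)).const_smul _).const_smul _

theorem continuousOn_cauchyCoeff {X : Type*} [TopologicalSpace X] {U : Set X} {R : ℝ} (hR : 0 < R)
    {G : X → ℂ → E} (hG : ContinuousOn (Function.uncurry G) (U ×ˢ Metric.sphere 0 R)) (n : ℕ) :
    ContinuousOn (fun x => cauchyCoeff R n (G x)) U :=
  (continuousOn_intervalIntegral _ _ (continuousOn_cauchy_integrand hR hG n)).const_smul _

/-- Taylor expansion in two variables with holomorphic dependence on a parameter. -/
theorem exists_taylorCoeff [CompleteSpace E] {U : Set ℂ} (hU : IsOpen U) {R R' M : ℝ} (hR : 0 < R)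
    (hRR' : R < R') {F : ℂ → ℂ × ℂ → E}
    (hF : DifferentiableOn ℂ (fun p : ℂ × (ℂ × ℂ) => F p.1 p.2) (U ×ˢ Metric.ball 0 R'))
    (hM : ∀ z ∈ U, ∀ w ∈ Metric.ball (0 : ℂ × ℂ) R', ‖F z w‖ ≤ M) :
    ∃ f : ℕ → ℕ → ℂ → E, (∀ p q, DifferentiableOn ℂ (f p q) U) ∧
      (∀ p q, ∀ z ∈ U, ‖f p q z‖ ≤ M * R⁻¹ ^ (p + q)) ∧
      ∀ z ∈ U, ∀ w ∈ Metric.ball (0 : ℂ × ℂ) R,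
        HasSum (fun x : ℕ × ℕ => (w.1 ^ x.1 * w.2 ^ x.2) • f x.1 x.2 z) (F z w) := by
  have hball : ∀ a b : ℂ, ‖a‖ ≤ R → ‖b‖ ≤ R → (a, b) ∈ Metric.ball (0 : ℂ × ℂ) R' := by
    intro a b ha hb
    rw [mem_ball_zero_iff, Prod.norm_def]
    exact (max_le ha hb).trans_lt hRR'
  have hopen : IsOpen (U ×ˢ Metric.ball (0 : ℂ × ℂ) R') := hU.prod Metric.isOpen_ball
  have hFat : ∀ z ∈ U, ∀ w ∈ Metric.ball (0 : ℂ × ℂ) R',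
      DifferentiableAt ℂ (fun p : ℂ × (ℂ × ℂ) => F p.1 p.2) (z, w) := fun z hz w hw =>
    hF.differentiableAt (hopen.mem_nhds ⟨hz, hw⟩)
  have hFz : ∀ a b : ℂ, ‖a‖ ≤ R → ‖b‖ ≤ R → DifferentiableOn ℂ (fun z => F z (a, b)) U :=
    fun a b ha hb z hz => ((hFat z hz _ (hball a b ha hb)).comp z
      (f := fun z => (z, (a, b))) (by fun_prop)).differentiableWithinAt
  have hFa : ∀ z ∈ U, ∀ a b : ℂ, ‖a‖ ≤ R → ‖b‖ ≤ R → DifferentiableAt ℂ (fun a => F z (a, b)) a :=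
    fun z hz a b ha hb => (hFat z hz _ (hball a b ha hb)).comp a
      (f := fun a => (z, (a, b))) (by fun_prop)
  have hFb : ∀ z ∈ U, ∀ a b : ℂ, ‖a‖ ≤ R → ‖b‖ ≤ R → DifferentiableAt ℂ (fun b => F z (a, b)) b :=
    fun z hz a b ha hb => (hFat z hz _ (hball a b ha hb)).comp b
      (f := fun b => (z, (a, b))) (by fun_prop)
  have hsphere : ∀ {ζ : ℂ}, ζ ∈ Metric.sphere (0 : ℂ) R → ‖ζ‖ ≤ R := fun h =>
    (mem_sphere_zero_iff_norm.1 h).le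
  have hcl : ∀ {ζ : ℂ}, ζ ∈ Metric.closedBall (0 : ℂ) R → ‖ζ‖ ≤ R := fun h =>
    mem_closedBall_zero_iff.1 h
  -- the coefficients with respect to the first variable
  set c : ℕ → ℂ → ℂ → E := fun p z b => cauchyCoeff R p fun a => F z (a, b) with hc
  have hc_cont : ∀ p, ContinuousOn (Function.uncurry (c p)) (U ×ˢ Metric.closedBall 0 R) := by
    intro p
    refine continuousOn_cauchyCoeff (X := ℂ × ℂ) hR (G := fun x a => F x.1 (a, x.2)) ?_ p
    refine hF.continuousOn.comp (f := fun y : (ℂ × ℂ) × ℂ => (y.1.1, (y.2, y.1.2)))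
      (by fun_prop) ?_
    rintro ⟨⟨z, b⟩, a⟩ ⟨⟨hz, hb⟩, ha⟩
    exact ⟨hz, hball a b (hsphere ha) (hcl hb)⟩
  have hc_z : ∀ p b, ‖b‖ ≤ R → DifferentiableOn ℂ (fun z => c p z b) U := by
    intro p b hb
    refine differentiableOn_cauchyCoeff hU hR (G := fun z a => F z (a, b)) ?_
      (fun a ha => hFz a b (hsphere ha) hb) p
    refine hF.continuousOn.comp (f := fun y : ℂ × ℂ => (y.1, (y.2, b))) (by fun_prop) ?_
    rintro ⟨z, a⟩ ⟨hz, ha⟩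
    exact ⟨hz, hball a b (hsphere ha) hb⟩
  have hc_b : ∀ p, ∀ z ∈ U, DiffContOnCl ℂ (c p z) (Metric.ball 0 R) := by
    intro p z hz
    refine ⟨?_, ?_⟩
    · refine differentiableOn_cauchyCoeff Metric.isOpen_ball hR (G := fun b a => F z (a, b)) ?_
        (fun a ha b hb => (hFb z hz a b (hsphere ha)
          (mem_ball_zero_iff.1 hb).le).differentiableWithinAt) p
      refine hF.continuousOn.comp (f := fun y : ℂ × ℂ => (z, (y.2, y.1))) (by fun_prop) ?_
      rintro ⟨b, a⟩ ⟨hb, ha⟩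
      exact ⟨hz, hball a b (hsphere ha) (mem_ball_zero_iff.1 hb).le⟩
    · rw [closure_ball _ hR.ne']
      exact (hc_cont p).comp (f := fun b => (z, b)) (by fun_prop) fun b hb => ⟨hz, hb⟩
  have hc_le : ∀ p, ∀ z ∈ U, ∀ b, ‖b‖ ≤ R → ‖c p z b‖ ≤ M * R⁻¹ ^ p := fun p z hz b hb =>
    norm_cauchyCoeff_le hR (fun a ha => hM z hz _ (hball a b (hsphere ha) hb)) p
  have hf_le : ∀ p q, ∀ z ∈ U, ‖cauchyCoeff R q (c p z)‖ ≤ M * R⁻¹ ^ (p + q) := by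
    intro p q z hz
    rw [pow_add, ← mul_assoc]
    exact norm_cauchyCoeff_le hR (fun b hb => hc_le p z hz b (hsphere hb)) q
  refine ⟨fun p q z => cauchyCoeff R q (c p z), fun p q => ?_, hf_le, ?_⟩
  · exact differentiableOn_cauchyCoeff hU hR
      ((hc_cont p).mono (Set.prod_mono le_rfl Metric.sphere_subset_closedBall))
      (fun b hb => hc_z p b (hsphere hb)) q
  · intro z hz w hw
    obtain ⟨h1, h2⟩ : ‖w.1‖ < R ∧ ‖w.2‖ < R := by
      rwa [mem_ball_zero_iff, Prod.norm_def, max_lt_iff] at hw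
    have hs : Summable fun x : ℕ × ℕ =>
        (w.1 ^ x.1 * w.2 ^ x.2) • cauchyCoeff R x.2 (c x.1 z) := by
      have hg : ∀ {a : ℂ}, ‖a‖ < R → Summable fun n : ℕ => (‖a‖ * R⁻¹) ^ n := fun {a} ha =>
        summable_geometric_of_lt_one (by positivity) (by
          rw [← div_eq_mul_inv, div_lt_one hR]; exact ha)
      refine Summable.of_norm_bounded (((hg h1).mul_of_nonneg (hg h2) (fun _ => by positivity)
        fun _ => by positivity).mul_left M) fun x => ?_
      rw [norm_smul, norm_mul, norm_pow, norm_pow]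
      calc ‖w.1‖ ^ x.1 * ‖w.2‖ ^ x.2 * ‖cauchyCoeff R x.2 (c x.1 z)‖
          ≤ ‖w.1‖ ^ x.1 * ‖w.2‖ ^ x.2 * (M * R⁻¹ ^ (x.1 + x.2)) :=
            mul_le_mul_of_nonneg_left (hf_le _ _ z hz) (by positivity)
        _ = _ := by rw [mul_pow, mul_pow, pow_add]; ring
    have e1 : HasSum (fun p => w.1 ^ p • c p z w.2) (F z w) :=
      hasSum_cauchyCoeff (G := fun a => F z (a, w.2)) hR ⟨fun a ha => (hFa z hz a w.2
        (mem_ball_zero_iff.1 ha).le h2.le).differentiableWithinAt, by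
          rw [closure_ball _ hR.ne']
          exact fun a ha => (hFa z hz a w.2 (hcl ha) h2.le).continuousAt.continuousWithinAt⟩ h1
    -- Absolute convergence of the double family allows summing first in the second variable, which
    -- recovers the one-variable expansion `e1`.
    have e2 := hs.hasSum.prod_fiberwise (g := fun p => w.1 ^ p • c p z w.2) fun p => by
      simp only [mul_smul]
      exact (hasSum_cauchyCoeff hR (hc_b p z hz) h2).const_smul _
    rw [e1.unique e2]
    exact hs.hasSum

end Taylor

theorem hasDerivAt_zero_of_hasSum {E : Type*} [NormedAddCommGroup E] [NormedSpace ℂ E]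
    {f : ℂ → E} {a : ℕ → E} (h : ∀ᶠ t in 𝓝 (0 : ℂ), HasSum (fun n => t ^ n • a n) (f t)) :
    HasDerivAt f (a 1) 0 := by
  let p : FormalMultilinearSeries ℂ ℂ E := fun n =>
    ContinuousMultilinearMap.mkPiRing ℂ (Fin n) (a n)
  have hcoeff : ∀ n, p.coeff n = a n := fun n => by simp [p, FormalMultilinearSeries.coeff]
  have hp : HasFPowerSeriesAt f p 0 := by
    rw [hasFPowerSeriesAt_iff]
    filter_upwards [h] with t ht
    simpa [hcoeff] using ht
  rw [← hcoeff]
  exact hp.hasDerivAt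

/-! ### Differentiability in the real parameter -/

section SecondOrder

variable {α : ℂ → ℂ × ℂ} {I : Set ℝ} {t B : ℝ}

theorem norm_deriv_le_of_tube (ht : 0 < t)
    (hd : ∀ r ∈ I, DifferentiableOn ℂ α (Metric.ball (r : ℂ) t))
    (hb : ∀ r ∈ I, ∀ z ∈ Metric.ball (r : ℂ) t, ‖α z‖ ≤ B) {r : ℝ} (hr : r ∈ I) {z : ℂ}
    (hz : z ∈ Metric.ball (r : ℂ) (t / 2)) : ‖deriv α z‖ ≤ 4 * B / t := by
  have hsub : Metric.closedBall z (t / 4) ⊆ Metric.ball (r : ℂ) t := by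
    refine Metric.closedBall_subset_ball' ?_
    have := Metric.mem_ball.1 hz
    linarith
  have := Complex.norm_deriv_le_of_forall_mem_sphere_norm_le (by positivity : 0 < t / 4)
    ((hd r hr).diffContOnCl_ball hsub) fun w hw => hb r hr w (hsub (Metric.sphere_subset_closedBall hw))
  refine this.trans_eq ?_
  field_simp

theorem hasDerivAt_comp_ofReal {a : ℂ × ℂ} {x : ℝ} (h : HasDerivAt α a (x : ℂ)) :
    HasDerivAt (fun y : ℝ => α y) a x := by
  have := h.scomp x Complex.ofRealCLM.hasDerivAt
  simp only [Complex.ofRealCLM_apply, Complex.ofReal_one, one_smul] at this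
  exact this

/-- Two Cauchy estimates on circles of radius `t / 4` bound the second derivative on the interval by
`(4 / t) * (4 * B / t)`; the mean value inequality along `I` does the rest. -/
theorem norm_deriv_sub_le_of_tube (hI : Convex ℝ I) (ht : 0 < t)
    (hd : ∀ r ∈ I, DifferentiableOn ℂ α (Metric.ball (r : ℂ) t))
    (hb : ∀ r ∈ I, ∀ z ∈ Metric.ball (r : ℂ) t, ‖α z‖ ≤ B) {r s : ℝ} (hr : r ∈ I) (hs : s ∈ I) :
    ‖deriv α s - deriv α r‖ ≤ 16 * B / t ^ 2 * ‖s - r‖ := by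
  have hd' : ∀ x ∈ I, DifferentiableOn ℂ (deriv α) (Metric.ball (x : ℂ) t) := fun x hx =>
    (hd x hx).deriv Metric.isOpen_ball
  refine Convex.norm_image_sub_le_of_norm_hasDerivWithin_le (𝕜 := ℝ)
    (f := fun x : ℝ => deriv α x) (f' := fun x => deriv (deriv α) x) (fun x hx => ?_)
    (fun x hx => ?_) hI hr hs
  · exact (hasDerivAt_comp_ofReal ((hd' x hx).differentiableAt
      (Metric.ball_mem_nhds _ ht)).hasDerivAt).hasDerivWithinAt
  · have hsub : Metric.closedBall (x : ℂ) (t / 4) ⊆ Metric.ball (x : ℂ) (t / 2) :=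
      Metric.closedBall_subset_ball (by linarith)
    have := Complex.norm_deriv_le_of_forall_mem_sphere_norm_le (by positivity : 0 < t / 4)
      ((hd' x hx).diffContOnCl_ball (hsub.trans (Metric.ball_subset_ball (by linarith))))
      fun w hw => norm_deriv_le_of_tube ht hd hb hx (hsub (Metric.sphere_subset_closedBall hw))
    refine this.trans_eq ?_
    field_simp
    ring

/-- Apply the mean value inequality on the segment from `r` to `s` to `α x - x • deriv α r`, whose
derivative is small by the Lipschitz bound for `deriv α`. The linear rate is explicit, so it can be
summed over the coefficients. -/
theorem norm_slope_sub_deriv_le_of_tube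
    (hI : Convex ℝ I) (ht : 0 < t)
    (hd : ∀ r ∈ I, DifferentiableOn ℂ α (Metric.ball (r : ℂ) t))
    (hb : ∀ r ∈ I, ∀ z ∈ Metric.ball (r : ℂ) t, ‖α z‖ ≤ B) {r s : ℝ} (hr : r ∈ I) (hs : s ∈ I)
    (hrs : s ≠ r) :
    ‖(s - r)⁻¹ • (α s - α r) - deriv α r‖ ≤ 16 * B / t ^ 2 * ‖s - r‖ := by
  have hsr : s - r ≠ 0 := sub_ne_zero.2 hrs
  have hseg : segment ℝ r s ⊆ I := hI.segment_subset hr hs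
  have key : ‖(α s - s • deriv α r) - (α r - r • deriv α r)‖
      ≤ 16 * B / t ^ 2 * ‖s - r‖ * ‖s - r‖ := by
    refine Convex.norm_image_sub_le_of_norm_hasDerivWithin_le (𝕜 := ℝ)
      (f := fun x : ℝ => α x - x • deriv α r) (f' := fun x => deriv α x - deriv α r)
      (s := segment ℝ r s) (fun x hx => ?_) (fun x hx => ?_) (convex_segment r s)
      (left_mem_segment ℝ r s) (right_mem_segment ℝ r s)
    · have h1 : HasDerivAt (fun x : ℝ => α x) (deriv α x) x :=
        hasDerivAt_comp_ofReal
          ((hd x (hseg hx)).differentiableAt (Metric.ball_mem_nhds _ ht)).hasDerivAt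
      have h2 : HasDerivAt (fun x : ℝ => x • deriv α (r : ℂ)) (deriv α r) x := by
        simpa using (hasDerivAt_id x).smul_const (deriv α (r : ℂ))
      exact (h1.sub h2).hasDerivWithinAt
    · refine (norm_deriv_sub_le_of_tube hI ht hd hb hr (hseg hx)).trans ?_
      have hB : 0 ≤ B := (norm_nonneg _).trans (hb r hr r (Metric.mem_ball_self ht))
      refine mul_le_mul_of_nonneg_left ?_ (by positivity)
      obtain ⟨a, b, ha, hb, hab, rfl⟩ := hx
      have : a • r + b • s - r = b * (s - r) := by
        simp only [smul_eq_mul]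
        rw [← eq_sub_iff_add_eq] at hab
        rw [hab]; ring
      rw [this, norm_mul, Real.norm_of_nonneg hb]
      exact mul_le_of_le_one_left (norm_nonneg _) (by linarith)
  have e : (s - r)⁻¹ • (α s - α r) - deriv α r
      = (s - r)⁻¹ • ((α s - s • deriv α r) - (α r - r • deriv α r)) := by
    have : (α s - s • deriv α r) - (α r - r • deriv α r)
        = (α s - α r) - (s - r) • deriv α (r : ℂ) := by rw [sub_smul]; abel
    rw [this, smul_sub _ (_ - _), smul_smul, inv_mul_cancel₀ hsr, one_smul]
  rw [e, norm_smul, norm_inv, inv_mul_le_iff₀ (norm_pos_iff.2 hsr)]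
  linarith

end SecondOrder

theorem tendstoCompactOpen_of_norm_sub_le {f : ℝ → ℂ → ℂ × ℂ} {g : ℂ → ℂ × ℂ} {I : Set ℝ}
    {U : Set ℂ} {r C : ℝ} (h : ∀ s ∈ I, ∀ w ∈ U, ‖f s w - g w‖ ≤ C * ‖s - r‖) :
    TendstoCompactOpen f g (𝓝[I] r) U := by
  intro K hK _
  rw [Metric.tendstoUniformlyOn_iff]
  intro ε hε
  have h0 : Tendsto (fun s : ℝ => C * ‖s - r‖) (𝓝[I] r) (𝓝 0) := by
    have : Continuous fun s : ℝ => C * ‖s - r‖ := by fun_prop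
    have := (this.tendsto r).mono_left (nhdsWithin_le_nhds (s := I))
    simpa using this
  filter_upwards [h0.eventually_lt_const hε, self_mem_nhdsWithin] with s hs hsI w hw
  rw [dist_comm, dist_eq_norm]
  exact (h s hsI w (hK hw)).trans_lt hs

/-- A power series whose coefficients extend holomorphically to discs of radius `t k` around the
points of an interval, with suitable bounds, is a `C¹` family of holomorphic maps. -/
theorem isC1HolomorphicFamily_tsum {α : ℕ → ℂ → ℂ × ℂ} {I : Set ℝ} {t B : ℕ → ℝ} {ρ : ℝ}
    (hI : Convex ℝ I) (ht : ∀ k, 0 < t k) (ht1 : ∀ k, t k ≤ 1)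
    (hd : ∀ k, ∀ r ∈ I, DifferentiableOn ℂ (α k) (Metric.ball (r : ℂ) (t k)))
    (hb : ∀ k, ∀ r ∈ I, ∀ z ∈ Metric.ball (r : ℂ) (t k), ‖α k z‖ ≤ B k)
    (hs : Summable fun k => B k / t k ^ 2 * ρ ^ k) :
    IsC1HolomorphicFamily (fun r w => ∑' k, w ^ k • α k r) I (Metric.ball 0 ρ) := by
  rcases I.eq_empty_or_nonempty with rfl | ⟨r₀, hr₀⟩
  · exact ⟨by simp, fun _ _ => 0, by simp⟩
  have hB : ∀ k, 0 ≤ B k := fun k =>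
    (norm_nonneg _).trans (hb k r₀ hr₀ r₀ (Metric.mem_ball_self (ht k)))
  have hw : ∀ {a : ℕ → ℂ × ℂ} {c : ℝ}, (∀ k, ‖a k‖ ≤ c * (B k / t k ^ 2)) →
      ∀ w ∈ Metric.ball (0 : ℂ) ρ, ∀ k, ‖w ^ k • a k‖ ≤ c * (B k / t k ^ 2 * ρ ^ k) := by
    intro a c ha w hw k
    rw [norm_smul, norm_pow, mul_comm, ← mul_assoc]
    have h1 : ‖w‖ ^ k ≤ ρ ^ k := pow_le_pow_left₀ (norm_nonneg _) (mem_ball_zero_iff.1 hw).le k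
    exact mul_le_mul (ha k) h1 (by positivity) ((norm_nonneg _).trans (ha k))
  have hsq : ∀ k, t k ^ 2 ≤ 1 := fun k => pow_le_one₀ (ht k).le (ht1 k)
  have b0 : ∀ r ∈ I, ∀ k, ‖α k r‖ ≤ 1 * (B k / t k ^ 2) := fun r hr k => by
    rw [one_mul, le_div_iff₀ (by have := ht k; positivity)]
    exact (mul_le_of_le_one_right (norm_nonneg _) (hsq k)).trans
      (hb k r hr r (Metric.mem_ball_self (ht k)))
  have b1 : ∀ r ∈ I, ∀ k, ‖deriv (α k) r‖ ≤ 4 * (B k / t k ^ 2) := fun r hr k => by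
    refine (norm_deriv_le_of_tube (ht k) (hd k) (hb k) hr
      (Metric.mem_ball_self (half_pos (ht k)))).trans ?_
    rw [mul_div_assoc]
    refine mul_le_mul_of_nonneg_left (div_le_div_of_nonneg_left (hB k)
      (by have := ht k; positivity) ?_) (by norm_num)
    rw [sq]
    exact mul_le_of_le_one_right (ht k).le (ht1 k)
  have hsum : ∀ {a : ℕ → ℂ × ℂ} {c : ℝ}, (∀ k, ‖a k‖ ≤ c * (B k / t k ^ 2)) →
      ∀ w ∈ Metric.ball (0 : ℂ) ρ, Summable fun k => w ^ k • a k := fun ha w hw' =>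
    Summable.of_norm_bounded (hs.mul_left _) (hw ha w hw')
  have hnorm : ∀ {a : ℕ → ℂ × ℂ} {c : ℝ}, (∀ k, ‖a k‖ ≤ c * (B k / t k ^ 2)) →
      ∀ w ∈ Metric.ball (0 : ℂ) ρ,
        ‖∑' k, w ^ k • a k‖ ≤ c * ∑' k, B k / t k ^ 2 * ρ ^ k := fun ha w hw' => by
    rw [← tsum_mul_left]
    exact tsum_of_norm_bounded (hs.mul_left _).hasSum (hw ha w hw')
  have hdiff : ∀ {a : ℕ → ℂ × ℂ} {c : ℝ}, (∀ k, ‖a k‖ ≤ c * (B k / t k ^ 2)) →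
      DifferentiableOn ℂ (fun w : ℂ => ∑' k, w ^ k • a k) (Metric.ball 0 ρ) := fun ha =>
    Complex.differentiableOn_tsum_of_summable_norm (hs.mul_left _)
      (fun k => ((differentiable_pow k).smul_const _).differentiableOn) Metric.isOpen_ball
      fun k w hw' => hw ha w hw' k
  refine ⟨fun r hr => hdiff (b0 r hr), fun r w => ∑' k, w ^ k • deriv (α k) r, fun r hr =>
    ⟨hdiff (b1 r hr), ?_, ?_⟩⟩
  · refine tendstoCompactOpen_of_norm_sub_le
      (C := 16 * ∑' k, B k / t k ^ 2 * ρ ^ k) fun s hs' w hw' => ?_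
    have hsI := hs'.1
    have e : (s - r)⁻¹ • (∑' k, w ^ k • α k s - ∑' k, w ^ k • α k r)
        - ∑' k, w ^ k • deriv (α k) r
        = ∑' k, w ^ k • ((s - r)⁻¹ • (α k s - α k r) - deriv (α k) r) := by
      have h1 := hsum (b0 s hsI) w hw'
      have h2 := hsum (b0 r hr) w hw'
      have h3 := hsum (b1 r hr) w hw'
      rw [← h1.tsum_sub h2, ← (h1.sub h2).tsum_const_smul, ← ((h1.sub h2).const_smul _).tsum_sub h3]
      refine tsum_congr fun k => ?_
      rw [smul_sub (w ^ k), smul_comm (w ^ k), smul_sub (w ^ k)]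
    rw [e]
    refine (hnorm (c := 16 * ‖s - r‖) (fun k => ?_) w hw').trans_eq (by ring)
    refine (norm_slope_sub_deriv_le_of_tube hI (ht k) (hd k) (hb k) hr hsI hs'.2).trans_eq ?_
    ring
  · refine tendstoCompactOpen_of_norm_sub_le
      (C := 16 * ∑' k, B k / t k ^ 2 * ρ ^ k) fun s hsI w hw' => ?_
    rw [← (hsum (b1 s hsI) w hw').tsum_sub (hsum (b1 r hr) w hw')]
    simp only [← smul_sub]
    refine (hnorm (c := 16 * ‖s - r‖) (fun k => ?_) w hw').trans_eq (by ring)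
    refine (norm_deriv_sub_le_of_tube hI (ht k) (hd k) (hb k) hr hsI).trans_eq ?_
    ring

/-! ### Small perturbations of the linear embedding -/

theorem norm_pow_sub_pow_le {ρ : ℝ} {z w : ℂ} (hz : z ∈ Metric.ball (0 : ℂ) ρ)
    (hw : w ∈ Metric.ball (0 : ℂ) ρ) (k : ℕ) :
    ‖w ^ k - z ^ k‖ ≤ k * ρ ^ (k - 1) * ‖w - z‖ := by
  refine Convex.norm_image_sub_le_of_norm_hasDerivWithin_le (𝕜 := ℂ) (f := fun z : ℂ => z ^ k)
    (f' := fun z => k * z ^ (k - 1)) (fun x _ => (hasDerivAt_pow k x).hasDerivWithinAt)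
    (fun x hx => ?_) (convex_ball 0 ρ) hz hw
  rw [norm_mul, norm_pow, Complex.norm_natCast]
  exact mul_le_mul_of_nonneg_left
    (pow_le_pow_left₀ (norm_nonneg _) (mem_ball_zero_iff.1 hx).le _) (by positivity)

/-- A power series which is a small perturbation of `w ↦ (w, 0)` is an injective immersion. -/
theorem injective_immersion_of_small {a : ℕ → ℂ × ℂ} {ρ : ℝ} (hρ : 0 < ρ) {ψ : ℂ → ℂ × ℂ}
    (hψ : ∀ w ∈ Metric.ball (0 : ℂ) ρ, HasSum (fun k => w ^ k • a k) (ψ w))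
    (hdiff : ∀ w ∈ Metric.ball (0 : ℂ) ρ, DifferentiableAt ℂ ψ w)
    (h0 : a 0 = 0) (h1 : a 1 = (1, 0))
    (h : ∀ k, 2 ≤ k → ‖a k‖ * (k * ρ ^ (k - 1)) ≤ 1 / 4 * (1 / 2) ^ k) :
    Set.InjOn ψ (Metric.ball 0 ρ) ∧ (∀ w ∈ Metric.ball (0 : ℂ) ρ, deriv ψ w ≠ 0) ∧
      ψ 0 = (0, 0) ∧ HasDerivAt ψ (1, 0) 0 := by
  have hd0 : HasDerivAt ψ (1, 0) 0 := by
    rw [← h1]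
    refine hasDerivAt_zero_of_hasSum ?_
    filter_upwards [Metric.ball_mem_nhds 0 hρ] with w hw using hψ w hw
  have hψ0 : ψ 0 = (0, 0) := by
    refine (hψ 0 (Metric.mem_ball_self hρ)).unique ?_
    have : (fun k : ℕ => (0 : ℂ) ^ k • a k) = fun _ => 0 := by
      ext1 k
      rcases k with _ | k
      · simp [h0]
      · simp
    rw [this]
    exact hasSum_zero
  -- The nonlinear remainder is a contraction with constant `1 / 2`. Equal values of `ψ` at `z, w`
  -- would make `e` move by the full `‖w - z‖`, and a zero of `deriv ψ` would give `e` a derivative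
  -- of norm `1`.
  set e : ℂ → ℂ × ℂ := fun w => ψ w - (w, 0) with he
  have hlip : ∀ z ∈ Metric.ball (0 : ℂ) ρ, ∀ w ∈ Metric.ball (0 : ℂ) ρ,
      ‖e w - e z‖ ≤ 1 / 2 * ‖w - z‖ := by
    intro z hz w hw
    have hsum : HasSum (fun k => (w ^ k - z ^ k) • a k - if k = 1 then (w - z, (0 : ℂ)) else 0)
        (e w - e z) := by
      have := ((hψ w hw).sub (hψ z hz)).sub (hasSum_ite_eq 1 (w - z, (0 : ℂ)))
      simp only [← sub_smul] at this
      rwa [show e w - e z = ψ w - ψ z - (w - z, (0 : ℂ)) by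
        ext
        · simp only [he, Prod.fst_sub]; ring
        · simp only [he, Prod.snd_sub]; ring]
    have hgeo : HasSum (fun k : ℕ => 1 / 4 * (1 / 2 : ℝ) ^ k * ‖w - z‖) (1 / 2 * ‖w - z‖) := by
      have := ((hasSum_geometric_of_lt_one (by norm_num)
        (by norm_num : (1 / 2 : ℝ) < 1)).mul_left (1 / 4)).mul_right ‖w - z‖
      rwa [show (1 / 4 : ℝ) * (1 - 1 / 2)⁻¹ = 1 / 2 by norm_num] at this
    rw [← hsum.tsum_eq]
    refine tsum_of_norm_bounded hgeo fun k => ?_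
    rcases Nat.lt_or_ge k 2 with hk | hk
    · interval_cases k
      · simp only [pow_zero, sub_self, zero_smul, zero_ne_one, if_false, norm_zero]
        positivity
      · simp only [h1, pow_one, if_true, Prod.smul_mk, smul_eq_mul, mul_one, mul_zero, sub_self,
          norm_zero]
        positivity
    · rw [if_neg (by omega), sub_zero, norm_smul]
      calc ‖w ^ k - z ^ k‖ * ‖a k‖ ≤ (k * ρ ^ (k - 1) * ‖w - z‖) * ‖a k‖ :=
            mul_le_mul_of_nonneg_right (norm_pow_sub_pow_le hz hw k) (norm_nonneg _)
        _ = ‖a k‖ * (k * ρ ^ (k - 1)) * ‖w - z‖ := by ring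
        _ ≤ _ := mul_le_mul_of_nonneg_right (h k hk) (norm_nonneg _)
  refine ⟨fun z hz w hw hzw => ?_, fun w hw hder => ?_, hψ0, hd0⟩
  · have h2 := hlip z hz w hw
    have h3 : e w - e z = (z - w, 0) := by
      simp only [he, hzw]
      ext <;> simp
    rw [h3, Prod.norm_mk, norm_zero, max_eq_left (norm_nonneg _), norm_sub_rev] at h2
    have h4 : ‖w - z‖ = 0 := le_antisymm (by linarith) (norm_nonneg _)
    exact (sub_eq_zero.1 (norm_eq_zero.1 h4)).symm
  · have hlipe : LipschitzOnWith (1 / 2) e (Metric.ball 0 ρ) :=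
      LipschitzOnWith.of_dist_le_mul fun x hx y hy => by
        rw [dist_eq_norm, dist_eq_norm]
        simpa using hlip y hy x hx
    have h2 := norm_deriv_le_of_lipschitzOn (Metric.isOpen_ball.mem_nhds hw) hlipe
    have h3 : HasDerivAt (fun w : ℂ => (w, (0 : ℂ))) (1, 0) w :=
      (hasDerivAt_id w).prodMk (hasDerivAt_const w 0)
    have h4 : HasDerivAt e (0 - (1, 0)) w :=
      (hder ▸ (hdiff w hw).hasDerivAt).sub h3
    rw [h4.deriv, zero_sub, norm_neg, Prod.norm_mk] at h2
    norm_num at h2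

/-! ### Small divisors on and near the ray -/

/-- The moduli of `t * u` and `1` differ by `|1 - t|`, which is also the distance from `u` to `t *
u`; the triangle inequality then loses only a factor `2`. -/
theorem half_norm_sub_one_le {u : ℂ} (hu : ‖u‖ = 1) {t : ℝ} (ht : 0 ≤ t) :
    ‖u - 1‖ / 2 ≤ ‖(t : ℂ) * u - 1‖ := by
  have h1 : ‖u - (t : ℂ) * u‖ = |1 - t| := by
    rw [show u - (t : ℂ) * u = ((1 - t : ℝ) : ℂ) * u by push_cast; ring, norm_mul, hu, mul_one,
      Complex.norm_real, Real.norm_eq_abs]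
  have h2 : ‖u - 1‖ ≤ ‖u - (t : ℂ) * u‖ + ‖(t : ℂ) * u - 1‖ := norm_sub_le_norm_sub_add_norm_sub ..
  have h3 : |1 - t| ≤ ‖(t : ℂ) * u - 1‖ := by
    have := abs_norm_sub_norm_le ((t : ℂ) * u) 1
    rwa [norm_mul, hu, mul_one, Complex.norm_real, Real.norm_of_nonneg ht, norm_one,
      abs_sub_comm] at this
  linarith

theorem norm_pow_sub_one_le_mul {u : ℂ} (hu : ‖u‖ = 1) (j : ℕ) :
    ‖u ^ j - 1‖ ≤ j * ‖u - 1‖ := by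
  induction j with
  | zero => simp
  | succ j ih =>
    have h : u ^ (j + 1) - 1 = u ^ j * (u - 1) + (u ^ j - 1) := by ring
    rw [h]
    refine (norm_add_le _ _).trans ?_
    rw [norm_mul, norm_pow, hu, one_pow, one_mul]
    push_cast
    linarith

/-- Moving along rays, and slightly off them, does not destroy the small divisor bounds. -/
theorem quarter_norm_pow_sub_one_le {lam : ℂ} (hlam : ‖lam‖ = 1) {ζ : ℂ} {r : ℝ} (hr : 0 ≤ r)
    (hζ : 1 / 2 ≤ ‖ζ‖) {j : ℕ} (h : 8 * (j : ℝ) * ‖ζ - r‖ ≤ ‖lam ^ j - 1‖) :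
    ‖lam ^ j - 1‖ / 4 ≤ ‖(ζ * lam) ^ j - 1‖ := by
  have hζ0 : ‖ζ‖ ≠ 0 := by linarith
  have hζC : (‖ζ‖ : ℂ) ≠ 0 := by exact_mod_cast hζ0
  -- Only the angular part `ω` of `ζ` can spoil a divisor; the modulus is a radial motion, handled
  -- by `half_norm_sub_one_le`.
  set ω : ℂ := ζ / ‖ζ‖ with hω
  have hω1 : ‖ω‖ = 1 := by simp [hω, hζ0]
  have hζω : ζ = ‖ζ‖ * ω := by rw [hω]; field_simp
  have h1 : ‖ω - 1‖ ≤ 4 * ‖ζ - r‖ := by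
    have e1 : ω - 1 = (ζ - ‖ζ‖) / ‖ζ‖ := by rw [hω]; field_simp
    have e2 : ‖ζ - (‖ζ‖ : ℂ)‖ ≤ 2 * ‖ζ - r‖ := by
      have a1 : ‖ζ - (‖ζ‖ : ℂ)‖ ≤ ‖ζ - r‖ + ‖(r : ℂ) - ‖ζ‖‖ := norm_sub_le_norm_sub_add_norm_sub ..
      have a2 : ‖(r : ℂ) - ‖ζ‖‖ ≤ ‖ζ - r‖ := by
        rw [← Complex.ofReal_sub, Complex.norm_real, Real.norm_eq_abs]
        have := abs_norm_sub_norm_le (r : ℂ) ζ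
        rwa [Complex.norm_real, Real.norm_of_nonneg hr, norm_sub_rev] at this
      linarith
    rw [e1, norm_div, Complex.norm_real, norm_norm, div_le_iff₀ (by linarith)]
    nlinarith [norm_nonneg (ζ - r)]
  have h2 : ‖lam ^ j - 1‖ ≤ ‖(ω * lam) ^ j - 1‖ + ‖ω ^ j - 1‖ := by
    have e : lam ^ j - 1 = ((ω * lam) ^ j - 1) - lam ^ j * (ω ^ j - 1) := by ring
    rw [e]
    refine (norm_sub_le _ _).trans_eq ?_
    rw [norm_mul, norm_pow, hlam, one_pow, one_mul]
  have h3 : ‖ω ^ j - 1‖ ≤ ‖lam ^ j - 1‖ / 2 := by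
    refine (norm_pow_sub_one_le_mul hω1 j).trans ?_
    have := mul_le_mul_of_nonneg_left h1 (Nat.cast_nonneg (α := ℝ) j)
    linarith
  have h4 : (ζ * lam) ^ j = ((‖ζ‖ ^ j : ℝ) : ℂ) * (ω * lam) ^ j := by
    conv_lhs => rw [hζω]
    push_cast
    ring
  have h5 : ‖(ω * lam) ^ j‖ = 1 := by rw [norm_pow, norm_mul, hω1, hlam, mul_one, one_pow]
  have h6 := half_norm_sub_one_le h5 (t := ‖ζ‖ ^ j) (by positivity)
  rw [h4]
  linarith

/-! ### Substituting convergent power series -/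

/-- The power series `P` converges absolutely at `w` to `x`, the sum of absolute values being at
most `S`. -/
def HasAbsSum (P : PowerSeries ℂ) (w x : ℂ) (S : ℝ) : Prop :=
  (Summable fun k => ‖PowerSeries.coeff k P * w ^ k‖) ∧
    ∑' k, PowerSeries.coeff k P * w ^ k = x ∧ ∑' k, ‖PowerSeries.coeff k P * w ^ k‖ ≤ S

theorem HasAbsSum.hasSum {P : PowerSeries ℂ} {w x : ℂ} {S : ℝ} (h : HasAbsSum P w x S) :
    HasSum (fun k => PowerSeries.coeff k P * w ^ k) x :=
  h.2.1 ▸ h.1.of_norm.hasSum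

theorem HasAbsSum.nonneg {P : PowerSeries ℂ} {w x : ℂ} {S : ℝ} (h : HasAbsSum P w x S) : 0 ≤ S :=
  (tsum_nonneg fun _ => norm_nonneg _).trans h.2.2

theorem HasAbsSum.one (w : ℂ) : HasAbsSum 1 w 1 1 := by
  have h : ∀ k, k ≠ 0 → PowerSeries.coeff k (1 : PowerSeries ℂ) * w ^ k = 0 := fun k hk => by
    simp [PowerSeries.coeff_one, hk]
  refine ⟨summable_of_ne_finset_zero (s := {0}) fun k hk => ?_, ?_, ?_⟩
  · rw [h k (by simpa using hk), norm_zero]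
  · rw [tsum_eq_single 0 h]; simp
  · rw [tsum_eq_single 0 fun k hk => by rw [h k hk, norm_zero]]; simp

theorem HasAbsSum.mul {P Q : PowerSeries ℂ} {w x y : ℂ} {S T : ℝ} (hP : HasAbsSum P w x S)
    (hQ : HasAbsSum Q w y T) : HasAbsSum (P * Q) w (x * y) (S * T) := by
  have e : ∀ k, PowerSeries.coeff k (P * Q) * w ^ k
      = ∑ z ∈ Finset.HasAntidiagonal.antidiagonal k,
        (PowerSeries.coeff z.1 P * w ^ z.1) * (PowerSeries.coeff z.2 Q * w ^ z.2) := by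
    intro k
    rw [PowerSeries.coeff_mul, Finset.sum_mul]
    refine Finset.sum_congr rfl fun z hz => ?_
    rw [← Finset.HasAntidiagonal.mem_antidiagonal.1 hz, pow_add]
    ring
  have hs := summable_norm_sum_mul_antidiagonal_of_summable_norm hP.1 hQ.1
  have hP' : Summable fun k => ‖‖PowerSeries.coeff k P * w ^ k‖‖ := by simpa using hP.1
  have hQ' : Summable fun k => ‖‖PowerSeries.coeff k Q * w ^ k‖‖ := by simpa using hQ.1
  simp only [HasAbsSum, e]
  refine ⟨hs, ?_, ?_⟩
  · rw [← tsum_mul_tsum_eq_tsum_sum_antidiagonal_of_summable_norm hP.1 hQ.1, hP.2.1, hQ.2.1]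
  · refine (hs.tsum_le_tsum (fun k => norm_sum_le _ _) ?_).trans ?_
    · simp only [norm_mul]
      have := (summable_norm_sum_mul_antidiagonal_of_summable_norm hP' hQ').of_norm
      simpa only [norm_mul] using this
    · have := tsum_mul_tsum_eq_tsum_sum_antidiagonal_of_summable_norm hP' hQ'
      simp only [norm_mul (_ * _)]
      rw [← this]
      exact mul_le_mul hP.2.2 hQ.2.2 (tsum_nonneg fun _ => norm_nonneg _) hP.nonneg

theorem HasAbsSum.pow {P : PowerSeries ℂ} {w x : ℂ} {S : ℝ} (hP : HasAbsSum P w x S) (n : ℕ) :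
    HasAbsSum (P ^ n) w (x ^ n) (S ^ n) := by
  induction n with
  | zero => simpa using HasAbsSum.one w
  | succ n ih => simpa only [pow_succ] using ih.mul hP

theorem coeff_pow_mul_pow_eq_zero {P Q : PowerSeries ℂ} (hP : PowerSeries.X ∣ P)
    (hQ : PowerSeries.X ∣ Q) {p q k : ℕ} (h : k < p + q) :
    PowerSeries.coeff k (P ^ p * Q ^ q) = 0 :=
  PowerSeries.X_pow_dvd_iff.1 (X_pow_dvd_pow_mul_pow hP hQ p q) k h

theorem nonlinCoeff_eq_zero (c : ℕ → ℕ → ℂ) {P Q : PowerSeries ℂ} (hP : PowerSeries.X ∣ P)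
    (hQ : PowerSeries.X ∣ Q) {k : ℕ} (hk : k < 2) : nonlinCoeff c P Q k = 0 :=
  Finset.sum_eq_zero fun x hx => by
    rw [coeff_pow_mul_pow_eq_zero hP hQ (hk.trans_le (Finset.mem_filter.1 hx).2), mul_zero]

/-- Substitution of power series into a double power series of order at least two. -/
theorem hasSum_nonlinCoeff {c : ℕ → ℕ → ℂ} {M R S : ℝ} (hR : 0 < R)
    (hc0 : ∀ p q, p + q < 2 → c p q = 0) (hc : ∀ p q, ‖c p q‖ ≤ M * R⁻¹ ^ (p + q))
    {P Q : PowerSeries ℂ} (hXP : PowerSeries.X ∣ P) (hXQ : PowerSeries.X ∣ Q) {w x y : ℂ}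
    (hP : HasAbsSum P w x S) (hQ : HasAbsSum Q w y S) (hS : S < R) {A : ℂ}
    (hA : HasSum (fun z : ℕ × ℕ => c z.1 z.2 * (x ^ z.1 * y ^ z.2)) A) :
    HasSum (fun k => nonlinCoeff c P Q k * w ^ k) A := by
  have hPQ : ∀ p q, HasAbsSum (P ^ p * Q ^ q) w (x ^ p * y ^ q) (S ^ p * S ^ q) := fun p q =>
    (hP.pow p).mul (hQ.pow q)
  set g : (ℕ × ℕ) × ℕ → ℂ := fun z =>
    c z.1.1 z.1.2 * (PowerSeries.coeff z.2 (P ^ z.1.1 * Q ^ z.1.2) * w ^ z.2) with hg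
  have hgeo : Summable fun n : ℕ => (S * R⁻¹) ^ n :=
    summable_geometric_of_lt_one (mul_nonneg hP.nonneg (by positivity)) (by
      rw [← div_eq_mul_inv, div_lt_one hR]; exact hS)
  have hgs : Summable g := by
    refine Summable.of_norm ((summable_prod_of_nonneg fun _ => norm_nonneg _).2
      ⟨fun z => ?_, ?_⟩)
    · simp only [hg, norm_mul (c _ _)]
      exact (hPQ z.1 z.2).1.mul_left _
    · have hnn : ∀ n : ℕ, 0 ≤ (S * R⁻¹) ^ n := fun n =>
        pow_nonneg (mul_nonneg hP.nonneg (by positivity)) n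
      refine Summable.of_nonneg_of_le (fun _ => tsum_nonneg fun _ => norm_nonneg _) (fun z => ?_)
        ((hgeo.mul_of_nonneg hgeo hnn hnn).mul_left M)
      simp only [hg, norm_mul (c _ _), tsum_mul_left]
      refine (mul_le_mul (hc _ _) (hPQ z.1 z.2).2.2 (tsum_nonneg fun _ => norm_nonneg _)
        ((norm_nonneg _).trans (hc _ _))).trans_eq ?_
      rw [mul_pow, mul_pow, pow_add]
      ring
  have h1 : HasSum (fun z : ℕ × ℕ => c z.1 z.2 * (x ^ z.1 * y ^ z.2)) (∑' z, g z) :=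
    hgs.hasSum.prod_fiberwise fun z => (hPQ z.1 z.2).hasSum.mul_left _
  rw [hA.unique h1]
  have h2 : HasSum (g ∘ Equiv.prodComm ℕ (ℕ × ℕ)) (∑' z, g z) :=
    (Equiv.prodComm ℕ (ℕ × ℕ)).hasSum_iff.2 hgs.hasSum
  refine h2.prod_fiberwise fun k => ?_
  rw [nonlinCoeff, Finset.sum_mul]
  simp only [mul_assoc]
  refine hasSum_sum_of_ne_finset_zero fun z hz => ?_
  rcases Nat.lt_or_ge (z.1 + z.2) 2 with h | h
  · simp [hg, hc0 _ _ h]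
  · have : k < z.1 + z.2 := by
      by_contra hk
      refine hz (Finset.mem_filter.2 ⟨Finset.mem_product.2 ⟨?_, ?_⟩, h⟩) <;>
        exact Finset.mem_range.2 (by omega)
    simp [hg, coeff_pow_mul_pow_eq_zero hXP hXQ this]

/-! ### The nonlinear part of the map -/

theorem hasFDerivAt_of_sub_isBigO_sq {g : ℂ × ℂ → ℂ} {L : ℂ × ℂ →L[ℂ] ℂ}
    (h : (fun z => g z - L z) =O[𝓝 (0, 0)] fun z => ‖z‖ ^ 2) :
    g 0 = 0 ∧ HasFDerivAt g L 0 := by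
  have h0 : g 0 = 0 := by
    -- The filter is the full neighbourhood filter, so the bound holds at the origin itself and
    -- forces the value there to vanish.
    obtain ⟨C, hC⟩ := h.bound
    have := hC.self_of_nhds
    rw [show ((0, 0) : ℂ × ℂ) = 0 from rfl] at this
    simpa using this
  refine ⟨h0, HasFDerivAt.of_isLittleO ?_⟩
  simp only [h0, sub_zero]
  refine h.trans_isLittleO ?_
  have : (fun z : ℂ × ℂ => ‖z‖ ^ 2) =o[𝓝 0] fun z => ‖z‖ ^ 1 :=
    isLittleO_norm_pow_norm_pow (by norm_num)
  simp only [pow_one] at this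
  exact isLittleO_norm_right.1 this

/-- The part of order at least two of the Taylor expansion of a map tangent to
`(z₁, z₂) ↦ (lam z₁, z₂)`. -/
theorem hasSum_nonlinear_part {f : ℕ → ℕ → ℂ × ℂ} {G : ℂ × ℂ → ℂ × ℂ} {R : ℝ} (hR : 0 < R) {lam : ℂ}
    (hf : ∀ w ∈ Metric.ball (0 : ℂ × ℂ) R,
      HasSum (fun x : ℕ × ℕ => (w.1 ^ x.1 * w.2 ^ x.2) • f x.1 x.2) (G w))
    (h₁ : (fun z : ℂ × ℂ => (G z).1 - lam * z.1) =O[𝓝 (0, 0)] fun z => ‖z‖ ^ 2)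
    (h₂ : (fun z : ℂ × ℂ => (G z).2 - z.2) =O[𝓝 (0, 0)] fun z => ‖z‖ ^ 2)
    {w : ℂ × ℂ} (hw : w ∈ Metric.ball (0 : ℂ × ℂ) R) :
    HasSum (fun x : ℕ × ℕ => (if 2 ≤ x.1 + x.2 then (f x.1 x.2).1 else 0) *
      (w.1 ^ x.1 * w.2 ^ x.2)) ((G w).1 - lam * w.1) ∧
    HasSum (fun x : ℕ × ℕ => (if 2 ≤ x.1 + x.2 then (f x.1 x.2).2 else 0) *
      (w.1 ^ x.1 * w.2 ^ x.2)) ((G w).2 - w.2) := by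
  obtain ⟨z₁, d₁⟩ := hasFDerivAt_of_sub_isBigO_sq (g := fun z => (G z).1)
    (L := lam • ContinuousLinearMap.fst ℂ ℂ ℂ) h₁
  obtain ⟨z₂, d₂⟩ := hasFDerivAt_of_sub_isBigO_sq (g := fun z => (G z).2)
    (L := ContinuousLinearMap.snd ℂ ℂ ℂ) h₂
  have hd : HasFDerivAt G ((lam • ContinuousLinearMap.fst ℂ ℂ ℂ).prod
      (ContinuousLinearMap.snd ℂ ℂ ℂ)) 0 := d₁.prodMk d₂
  have f00 : f 0 0 = 0 := by
    have e1 := hf 0 (Metric.mem_ball_self hR)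
    have e2 : HasSum (fun x : ℕ × ℕ =>
        (((0 : ℂ × ℂ).1 ^ x.1 * (0 : ℂ × ℂ).2 ^ x.2) • f x.1 x.2)) (f 0 0) := by
      convert hasSum_single ((0, 0) : ℕ × ℕ) ?_ using 1
      · simp
      · rintro ⟨p, q⟩ hpq
        rcases p with _ | p
        · rcases q with _ | q
          · exact absurd rfl hpq
          · simp
        · simp
    rw [e2.unique e1]
    exact Prod.ext z₁ z₂
  -- The linear Taylor coefficients are identified by restricting `G` to a coordinate axis and using
  -- uniqueness of the derivative.
  have f10 : f 1 0 = (lam, 0) := by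
    have e1 : HasDerivAt (fun t : ℂ => G (t, 0)) (f 1 0) 0 := by
      refine hasDerivAt_zero_of_hasSum (a := fun p => f p 0) ?_
      filter_upwards [Metric.ball_mem_nhds 0 hR] with t ht
      have h := hf (t, 0) (by
        rw [mem_ball_zero_iff, Prod.norm_mk, norm_zero]
        exact max_lt (mem_ball_zero_iff.1 ht) hR)
      have hinj : Function.Injective fun p : ℕ => (p, (0 : ℕ)) := fun a b hab =>
        (Prod.mk.inj hab).1
      have := (hinj.hasSum_iff (f := fun x : ℕ × ℕ => (t ^ x.1 * (0 : ℂ) ^ x.2) • f x.1 x.2)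
        (a := G (t, 0)) (fun x hx => ?_)).2 h
      · simpa [Function.comp_def] using this
      · have : x.2 ≠ 0 := fun h0 => hx ⟨x.1, Prod.ext rfl h0.symm⟩
        simp [this]
    have e2 : HasDerivAt (fun t : ℂ => G (t, 0)) (lam, 0) 0 := by
      have := HasFDerivAt.comp_hasDerivAt (0 : ℂ) (f := fun t : ℂ => (t, (0 : ℂ))) hd
        ((hasDerivAt_id (0 : ℂ)).prodMk (hasDerivAt_const 0 0))
      rwa [show ((lam • ContinuousLinearMap.fst ℂ ℂ ℂ).prod (ContinuousLinearMap.snd ℂ ℂ ℂ))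
        ((1 : ℂ), (0 : ℂ)) = (lam, 0) by simp] at this
    exact e1.unique e2
  have f01 : f 0 1 = (0, 1) := by
    have e1 : HasDerivAt (fun t : ℂ => G (0, t)) (f 0 1) 0 := by
      refine hasDerivAt_zero_of_hasSum (a := fun q => f 0 q) ?_
      filter_upwards [Metric.ball_mem_nhds 0 hR] with t ht
      have h := hf (0, t) (by
        rw [mem_ball_zero_iff, Prod.norm_mk, norm_zero]
        exact max_lt hR (mem_ball_zero_iff.1 ht))
      have hinj : Function.Injective fun q : ℕ => ((0 : ℕ), q) := fun a b hab =>
        (Prod.mk.inj hab).2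
      have := (hinj.hasSum_iff (f := fun x : ℕ × ℕ => ((0 : ℂ) ^ x.1 * t ^ x.2) • f x.1 x.2)
        (a := G (0, t)) (fun x hx => ?_)).2 h
      · simpa [Function.comp_def] using this
      · have : x.1 ≠ 0 := fun h0 => hx ⟨x.2, Prod.ext h0.symm rfl⟩
        simp [this]
    have e2 : HasDerivAt (fun t : ℂ => G (0, t)) (0, 1) 0 := by
      have := HasFDerivAt.comp_hasDerivAt (0 : ℂ) (f := fun t : ℂ => ((0 : ℂ), t)) hd
        ((hasDerivAt_const 0 0).prodMk (hasDerivAt_id (0 : ℂ)))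
      rwa [show ((lam • ContinuousLinearMap.fst ℂ ℂ ℂ).prod (ContinuousLinearMap.snd ℂ ℂ ℂ))
        ((0 : ℂ), (1 : ℂ)) = (0, 1) by simp] at this
    exact e1.unique e2
  have hsum := hf w hw
  have hs₁ := (hsum.map (AddMonoidHom.fst ℂ ℂ) continuous_fst).sub
    (hasSum_ite_eq ((1, 0) : ℕ × ℕ) (lam * w.1))
  have hs₂ := (hsum.map (AddMonoidHom.snd ℂ ℂ) continuous_snd).sub
    (hasSum_ite_eq ((0, 1) : ℕ × ℕ) w.2)
  have hcases : ∀ x : ℕ × ℕ, 2 ≤ x.1 + x.2 ∨ x = (0, 0) ∨ x = (1, 0) ∨ x = (0, 1) := by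
    rintro ⟨p, q⟩
    simp only [Prod.mk.injEq]
    omega
  constructor
  · refine hs₁.congr_fun fun x => ?_
    rcases hcases x with h | rfl | rfl | rfl
    · have hne : x ≠ (1, 0) := by rintro rfl; simp at h
      simp [h, hne, mul_comm]
    · simp [f00]
    · simp [f10, mul_comm]
    · simp [f01]
  · refine hs₂.congr_fun fun x => ?_
    rcases hcases x with h | rfl | rfl | rfl
    · have hne : x ≠ (0, 1) := by rintro rfl; simp at h
      simp [h, hne, mul_comm]
    · simp [f00]
    · simp [f10]
    · simp [f01]

/-! ### Coefficient bounds on shrinking discs -/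

/-- The radius gives `8 * j * ‖ζ - r‖ ≤ 8 * τ / j ^ N ≤ c / j ^ N` for every `j ≤ k + 1`, below the
Diophantine bound, so all divisors up to index `k + 1` survive up to a factor `4`. -/
theorem tube_bounds {lam : ℂ} (hlam : ‖lam‖ = 1) {c : ℝ} {N : ℕ}
    (hd : ∀ k : ℕ, 1 ≤ k → c < k ^ N * ‖lam ^ k - 1‖) {τ : ℝ} (hτ : 0 < τ) (hτc : 8 * τ ≤ c)
    (hτ4 : τ ≤ 1 / 4) {r : ℝ} (hr : 3 / 4 ≤ r) {k : ℕ} {ζ : ℂ}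
    (hζ : ζ ∈ Metric.ball (r : ℂ) (τ / ((k : ℝ) + 1) ^ (N + 1))) :
    ‖ζ - r‖ < τ ∧ 1 / 2 ≤ ‖ζ‖ ∧
      ∀ j, 1 ≤ j → j ≤ k + 1 → ‖lam ^ j - 1‖ / 4 ≤ ‖(ζ * lam) ^ j - 1‖ := by
  rw [mem_ball_iff_norm] at hζ
  have hk : (1 : ℝ) ≤ (k : ℝ) + 1 := by linarith [(Nat.cast_nonneg k : (0 : ℝ) ≤ k)]
  have h1 : ‖ζ - r‖ < τ := hζ.trans_le (div_le_self hτ.le (one_le_pow₀ hk))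
  have h2 : 1 / 2 ≤ ‖ζ‖ := by
    have := norm_sub_norm_le (r : ℂ) ζ
    rw [Complex.norm_real, Real.norm_of_nonneg (by linarith), norm_sub_rev] at this
    linarith
  refine ⟨h1, h2, fun j hj hjk =>
    quarter_norm_pow_sub_one_le hlam (r := r) (by linarith) h2 ?_⟩
  have hj0 : (0 : ℝ) < j := by exact_mod_cast hj
  have hjk' : (j : ℝ) ≤ k + 1 := by exact_mod_cast hjk
  have h3 : (j : ℝ) ^ (N + 1) * ‖ζ - r‖ ≤ τ := by
    calc (j : ℝ) ^ (N + 1) * ‖ζ - r‖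
        ≤ ((k : ℝ) + 1) ^ (N + 1) * (τ / ((k : ℝ) + 1) ^ (N + 1)) := by gcongr
      _ = τ := by field_simp
  have h4 := hd j hj
  refine le_of_mul_le_mul_left ?_ (pow_pos hj0 N)
  calc (j : ℝ) ^ N * (8 * j * ‖ζ - r‖) = 8 * ((j : ℝ) ^ (N + 1) * ‖ζ - r‖) := by ring
    _ ≤ (j : ℝ) ^ N * ‖lam ^ j - 1‖ := by linarith

/-- Since `lam ^ k - lam = lam * (lam ^ (k - 1) - 1)`, the divisors at `k - 1` and `k` cover both
components, and their product gives one weight for both. The `8` is the `4` from `h` times the `2`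
from `‖lam‖ ≥ 1 / 2`. -/
theorem norm_inv_pow_sub_le {lam₀ lam : ℂ} (hlam : 1 / 2 ≤ ‖lam‖) {k : ℕ} (hk : 2 ≤ k)
    (hpos : ∀ j : ℕ, 1 ≤ j → 0 < ‖lam₀ ^ j - 1‖)
    (h : ∀ j, 1 ≤ j → j ≤ k → ‖lam₀ ^ j - 1‖ / 4 ≤ ‖lam ^ j - 1‖) :
    ‖(lam ^ k - lam)⁻¹‖ ≤ 8 * (smallDiv lam₀ (k - 1) * smallDiv lam₀ k) ∧
      ‖(lam ^ k - 1)⁻¹‖ ≤ 8 * (smallDiv lam₀ (k - 1) * smallDiv lam₀ k) := by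
  have h1 : ‖lam₀ ^ (k - 1) - 1‖⁻¹ ≤ smallDiv lam₀ (k - 1) := le_max_right _ _
  have h2 : ‖lam₀ ^ k - 1‖⁻¹ ≤ smallDiv lam₀ k := le_max_right _ _
  have h3 := one_le_smallDiv lam₀ (k - 1)
  have h4 := one_le_smallDiv lam₀ k
  have p1 := hpos (k - 1) (by omega)
  have p2 := hpos k (by omega)
  constructor
  · have e : lam ^ k - lam = lam * (lam ^ (k - 1) - 1) := by
      rw [mul_sub, ← pow_succ', Nat.sub_add_cancel (by omega), mul_one]
    have h5 : ‖lam₀ ^ (k - 1) - 1‖ / 8 ≤ ‖lam ^ k - lam‖ := by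
      rw [e, norm_mul]
      have := h (k - 1) (by omega) (by omega)
      nlinarith [norm_nonneg (lam ^ (k - 1) - 1)]
    calc ‖(lam ^ k - lam)⁻¹‖ ≤ (‖lam₀ ^ (k - 1) - 1‖ / 8)⁻¹ := by
          rw [norm_inv]; exact inv_anti₀ (by positivity) h5
      _ = 8 * ‖lam₀ ^ (k - 1) - 1‖⁻¹ := by rw [inv_div, div_eq_mul_inv]
      _ ≤ _ := by nlinarith
  · calc ‖(lam ^ k - 1)⁻¹‖ ≤ (‖lam₀ ^ k - 1‖ / 4)⁻¹ := by
          rw [norm_inv]; exact inv_anti₀ (by positivity) (h k (by omega) le_rfl)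
      _ = 4 * ‖lam₀ ^ k - 1‖⁻¹ := by rw [inv_div, div_eq_mul_inv]
      _ ≤ _ := by nlinarith

/-- The formal invariant curve of the map with multiplier `lam` and nonlinear coefficients
`c₁ p q lam`, `c₂ p q lam`. -/
noncomputable def invariantSeries (c₁ c₂ : ℕ → ℕ → ℂ → ℂ) (lam : ℂ) :
    PowerSeries ℂ × PowerSeries ℂ :=
  formalSol (fun k => (lam ^ k - lam)⁻¹) (fun k => (lam ^ k - 1)⁻¹) (fun p q => c₁ p q lam)
    fun p q => c₂ p q lam

theorem invariantSeries_tube {lam₀ : ℂ} (hlam : ‖lam₀‖ = 1) {c : ℝ} (hc : 0 < c) {N : ℕ}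
    (hN : N ≠ 0) (hd : ∀ k : ℕ, 1 ≤ k → c < k ^ N * ‖lam₀ ^ k - 1‖) {c₁ c₂ : ℕ → ℕ → ℂ → ℂ}
    {ε R M : ℝ} (hε : 0 < ε) (hε2 : ε ≤ 1 / 2) (hR : 0 < R) (hM : 0 < M)
    (hd₁ : ∀ p q, DifferentiableOn ℂ (c₁ p q) (Metric.ball lam₀ ε))
    (hd₂ : ∀ p q, DifferentiableOn ℂ (c₂ p q) (Metric.ball lam₀ ε))
    (hc₁ : ∀ p q, ∀ z ∈ Metric.ball lam₀ ε, ‖c₁ p q z‖ ≤ M * R⁻¹ ^ (p + q))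
    (hc₂ : ∀ p q, ∀ z ∈ Metric.ball lam₀ ε, ‖c₂ p q z‖ ≤ M * R⁻¹ ^ (p + q)) :
    ∃ ρ C τ : ℝ, 0 < ρ ∧ 8 * ρ ≤ R ∧ 1 ≤ C ∧ 0 < τ ∧ τ ≤ 1 ∧
      ∀ r : ℝ, |r - 1| < ε / 2 → ∀ k : ℕ,
      ∀ ζ ∈ Metric.ball (r : ℂ) (τ / ((k : ℝ) + 1) ^ (N + 1)),
        ζ * lam₀ ∈ Metric.ball lam₀ ε ∧
        (∀ j, 2 ≤ j → j ≤ k + 1 → (ζ * lam₀) ^ j - ζ * lam₀ ≠ 0 ∧ (ζ * lam₀) ^ j - 1 ≠ 0) ∧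
        ‖(PowerSeries.coeff k (invariantSeries c₁ c₂ (ζ * lam₀)).1,
          PowerSeries.coeff k (invariantSeries c₁ c₂ (ζ * lam₀)).2)‖ ≤ 2 * ρ * (C / ρ) ^ k ∧
        DifferentiableAt ℂ (fun ζ => (PowerSeries.coeff k (invariantSeries c₁ c₂ (ζ * lam₀)).1,
          PowerSeries.coeff k (invariantSeries c₁ c₂ (ζ * lam₀)).2)) ζ := by
  obtain ⟨η, hη0, hη1, hηpos, ⟨C, hC1, hηC⟩, hη⟩ := exists_siegelWeight hlam hc hN hd
  have hpos : ∀ j : ℕ, 1 ≤ j → 0 < ‖lam₀ ^ j - 1‖ := fun j hj =>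
    pos_of_mul_pos_right (hc.trans (hd j hj)) (by positivity)
  -- These are the two smallness conditions of `norm_coeff_le_of_recursion` with `A = 8`.
  set ρ : ℝ := min (R / 8) (R ^ 2 / (256 * 8 * M)) with hρ
  have hρ0 : 0 < ρ := lt_min (by positivity) (by positivity)
  have hρ8 : 8 * ρ ≤ R := by
    have : ρ ≤ R / 8 := min_le_left _ _
    linarith
  have hρM : 256 * 8 * M * ρ ≤ R ^ 2 := by
    have : ρ ≤ R ^ 2 / (256 * 8 * M) := min_le_right _ _
    rw [le_div_iff₀ (by positivity)] at this
    linarith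
  set τ : ℝ := min (c / 8) (ε / 4) with hτ
  have hτ0 : 0 < τ := lt_min (by positivity) (by positivity)
  have hτc : 8 * τ ≤ c := by
    have : τ ≤ c / 8 := min_le_left _ _
    linarith
  have hτε : τ ≤ ε / 4 := min_le_right _ _
  refine ⟨ρ, C, τ, hρ0, hρ8, hC1, hτ0, by linarith, fun r hr k ζ hζ => ?_⟩
  have hr' := abs_lt.1 hr
  obtain ⟨b1, b2, b3⟩ := tube_bounds hlam hd hτ0 hτc (by linarith) (by linarith) hζ
  have hmem : ζ * lam₀ ∈ Metric.ball lam₀ ε := by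
    rw [mem_ball_iff_norm, show ζ * lam₀ - lam₀ = (ζ - 1) * lam₀ by ring, norm_mul, hlam, mul_one]
    have e1 : ‖ζ - 1‖ ≤ ‖ζ - r‖ + ‖(r : ℂ) - 1‖ := norm_sub_le_norm_sub_add_norm_sub ..
    have e2 : ‖(r : ℂ) - 1‖ = |r - 1| := by
      rw [← Complex.ofReal_one, ← Complex.ofReal_sub, Complex.norm_real, Real.norm_eq_abs]
    linarith
  have hnorm : 1 / 2 ≤ ‖ζ * lam₀‖ := by rwa [norm_mul, hlam, mul_one]
  have hne : ∀ j, 1 ≤ j → j ≤ k + 1 → (ζ * lam₀) ^ j - 1 ≠ 0 := fun j h1 h2 =>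
    norm_pos_iff.1 (lt_of_lt_of_le (by have := hpos j h1; positivity) (b3 j h1 h2))
  have hne' : ∀ j, 2 ≤ j → j ≤ k + 1 → (ζ * lam₀) ^ j - ζ * lam₀ ≠ 0 := by
    intro j h1 h2
    have e : (ζ * lam₀) ^ j - ζ * lam₀ = (ζ * lam₀) * ((ζ * lam₀) ^ (j - 1) - 1) := by
      rw [mul_sub, ← pow_succ', Nat.sub_add_cancel (by omega), mul_one]
    rw [e]
    exact mul_ne_zero (norm_pos_iff.1 (by linarith)) (hne _ (by omega) (by omega))
  refine ⟨hmem, fun j h1 h2 => ⟨hne' j h1 h2, hne j (by omega) h2⟩, ?_, ?_⟩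
  -- The cut-off `K = k` matters: at a nonreal `ζ` only finitely many divisors are controlled, and
  -- the coefficient at `k` needs no others.
  · have hcoef := norm_coeff_le_of_recursion (K := k) (A := 8) (M := M) (R := R) (ρ := ρ)
      (E := fun k => smallDiv lam₀ (k - 1) * smallDiv lam₀ k) hη0 hη1 hηpos
      (fun k => one_le_mul_of_one_le_of_one_le (one_le_smallDiv _ _) (one_le_smallDiv _ _)) hη
      (by norm_num) hM.le hR
      (fun j h1 h2 => (norm_inv_pow_sub_le hnorm h1 hpos
        fun i h3 h4 => b3 i h3 (by omega)).1)
      (fun j h1 h2 => (norm_inv_pow_sub_le hnorm h1 hpos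
        fun i h3 h4 => b3 i h3 (by omega)).2)
      (fun p q => hc₁ p q _ hmem) (fun p q => hc₂ p q _ hmem)
      (coeff_zero_formalSol _ _ _ _).1 (coeff_zero_formalSol _ _ _ _).2
      (coeff_one_formalSol _ _ _ _).1 (coeff_one_formalSol _ _ _ _).2
      (fun k hk => (coeff_formalSol _ _ _ _ hk).1) (fun k hk => (coeff_formalSol _ _ _ _ hk).2)
      hρ0 hρ8 hρM le_rfl
    have hle : 2 * ρ * (η k * ρ⁻¹ ^ k) ≤ 2 * ρ * (C / ρ) ^ k := by
      rw [div_eq_mul_inv, mul_pow]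
      have := hηC k
      gcongr
    rw [Prod.norm_mk]
    exact max_le (hcoef.1.trans hle) (hcoef.2.trans hle)
  · have hz : ∀ {g : ℂ → ℂ}, DifferentiableOn ℂ g (Metric.ball lam₀ ε) →
        DifferentiableAt ℂ g (ζ * lam₀) := fun hg =>
      hg.differentiableAt (Metric.isOpen_ball.mem_nhds hmem)
    have key := differentiableAt_coeff_formalApprox (u₁ := fun k lam => (lam ^ k - lam)⁻¹)
      (u₂ := fun k lam => (lam ^ k - 1)⁻¹) (z := ζ * lam₀) (n := k)
      (fun p q => hz (hd₁ p q)) (fun p q => hz (hd₂ p q))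
      (fun j h1 h2 => ((differentiableAt_pow j).sub differentiableAt_fun_id).inv (hne' j h1 h2))
      (fun j h1 h2 => ((differentiableAt_pow j).sub
        (differentiableAt_const 1)).inv (hne j (by omega) h2)) k
    have hm : DifferentiableAt ℂ (fun ζ : ℂ => ζ * lam₀) ζ := by fun_prop
    simp only [invariantSeries, formalSol, PowerSeries.coeff_mk]
    exact (key.1.comp ζ hm).prodMk (key.2.comp ζ hm)

theorem coeff_invariantSeries {c₁ c₂ : ℕ → ℕ → ℂ → ℂ} {lam : ℂ}
    (h : ∀ j, 2 ≤ j → lam ^ j - lam ≠ 0 ∧ lam ^ j - 1 ≠ 0) (k : ℕ) :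
    lam ^ k * PowerSeries.coeff k (invariantSeries c₁ c₂ lam).1
      = lam * PowerSeries.coeff k (invariantSeries c₁ c₂ lam).1
        + nonlinCoeff (fun p q => c₁ p q lam) (invariantSeries c₁ c₂ lam).1
          (invariantSeries c₁ c₂ lam).2 k ∧
    lam ^ k * PowerSeries.coeff k (invariantSeries c₁ c₂ lam).2
      = PowerSeries.coeff k (invariantSeries c₁ c₂ lam).2
        + nonlinCoeff (fun p q => c₂ p q lam) (invariantSeries c₁ c₂ lam).1
          (invariantSeries c₁ c₂ lam).2 k := by
  rcases Nat.lt_or_ge k 2 with hk | hk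
  · have hX := X_dvd_formalSol (fun k => (lam ^ k - lam)⁻¹) (fun k => (lam ^ k - 1)⁻¹)
      (fun p q => c₁ p q lam) fun p q => c₂ p q lam
    rw [invariantSeries, nonlinCoeff_eq_zero _ hX.1 hX.2 hk, nonlinCoeff_eq_zero _ hX.1 hX.2 hk]
    interval_cases k
    · simp [coeff_zero_formalSol, -PowerSeries.coeff_zero_eq_constantCoeff]
    · simp [coeff_one_formalSol]
  · obtain ⟨h1, h2⟩ := h k hk
    obtain ⟨e1, e2⟩ := coeff_formalSol (fun k => (lam ^ k - lam)⁻¹) (fun k => (lam ^ k - 1)⁻¹)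
      (fun p q => c₁ p q lam) (fun p q => c₂ p q lam) hk
    constructor
    · rw [← sub_eq_iff_eq_add', ← sub_mul]
      conv_lhs => rw [invariantSeries, e1]
      rw [mul_inv_cancel_left₀ h1]
      rfl
    · rw [← sub_eq_iff_eq_add', ← sub_one_mul]
      conv_lhs => rw [invariantSeries, e2]
      rw [mul_inv_cancel_left₀ h2]
      rfl

/-- A convergent formal invariant curve is an invariant curve. -/
theorem invariantSeries_functional {c₁ c₂ : ℕ → ℕ → ℂ → ℂ} {lam : ℂ}
    (h : ∀ j, 2 ≤ j → lam ^ j - lam ≠ 0 ∧ lam ^ j - 1 ≠ 0) {M R S : ℝ} (hR : 0 < R) (hS : S < R)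
    (h₁ : ∀ p q, p + q < 2 → c₁ p q lam = 0) (h₂ : ∀ p q, p + q < 2 → c₂ p q lam = 0)
    (hc₁ : ∀ p q, ‖c₁ p q lam‖ ≤ M * R⁻¹ ^ (p + q))
    (hc₂ : ∀ p q, ‖c₂ p q lam‖ ≤ M * R⁻¹ ^ (p + q)) {w x y x' y' : ℂ}
    (hx : HasAbsSum (invariantSeries c₁ c₂ lam).1 w x S)
    (hy : HasAbsSum (invariantSeries c₁ c₂ lam).2 w y S)
    (hx' : HasAbsSum (invariantSeries c₁ c₂ lam).1 (lam * w) x' S)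
    (hy' : HasAbsSum (invariantSeries c₁ c₂ lam).2 (lam * w) y' S) {G : ℂ × ℂ}
    (hG₁ : HasSum (fun z : ℕ × ℕ => c₁ z.1 z.2 lam * (x ^ z.1 * y ^ z.2)) (G.1 - lam * x))
    (hG₂ : HasSum (fun z : ℕ × ℕ => c₂ z.1 z.2 lam * (x ^ z.1 * y ^ z.2)) (G.2 - y)) :
    G = (x', y') := by
  have hX := X_dvd_formalSol (fun k => (lam ^ k - lam)⁻¹) (fun k => (lam ^ k - 1)⁻¹)
    (fun p q => c₁ p q lam) fun p q => c₂ p q lam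
  have n₁ := hasSum_nonlinCoeff hR h₁ hc₁ hX.1 hX.2 hx hy hS hG₁
  have n₂ := hasSum_nonlinCoeff hR h₂ hc₂ hX.1 hX.2 hx hy hS hG₂
  have hk := coeff_invariantSeries (c₁ := c₁) (c₂ := c₂) h
  refine Prod.ext ?_ ?_
  · have := (hx.hasSum.mul_left lam).add n₁
    rw [add_sub_cancel] at this
    refine this.unique (hx'.hasSum.congr_fun fun k => ?_)
    have e := (hk k).1
    simp only [invariantSeries] at e ⊢
    linear_combination -(w ^ k) * e
  · have := hy.hasSum.add n₂
    rw [add_sub_cancel] at this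
    refine this.unique (hy'.hasSum.congr_fun fun k => ?_)
    have e := (hk k).2
    simp only [invariantSeries] at e ⊢
    linear_combination -(w ^ k) * e

/-! ### Assembling the family of curves -/

theorem exists_nat_siegelCondition {lam : ℂ} (h : SiegelCondition lam) :
    ∃ c : ℝ, 0 < c ∧ ∃ N : ℕ, N ≠ 0 ∧ ∀ k : ℕ, 1 ≤ k → c < k ^ N * ‖lam ^ k - 1‖ := by
  obtain ⟨c, hc, N, -, hk⟩ := h
  refine ⟨c, hc, ⌈N⌉₊ + 1, by omega, fun k h1 => ?_⟩
  have h1' : (1 : ℝ) ≤ k := by exact_mod_cast h1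
  have h2 : ((k : ℝ) ^ (⌈N⌉₊ + 1))⁻¹ ≤ (k : ℝ) ^ (-N) := by
    rw [← Real.rpow_natCast, ← Real.rpow_neg (by positivity)]
    refine Real.rpow_le_rpow_of_exponent_le h1' ?_
    have := Nat.le_ceil N
    push_cast
    linarith
  have h3 : c * ((k : ℝ) ^ (⌈N⌉₊ + 1))⁻¹ < ‖lam ^ k - 1‖ :=
    (mul_le_mul_of_nonneg_left h2 hc.le).trans_lt (hk k h1)
  rwa [← div_eq_mul_inv, div_lt_iff₀' (by positivity)] at h3

theorem norm_rayPoint_one (θ : ℝ) : ‖rayPoint θ 1‖ = 1 := by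
  rw [rayPoint, Complex.ofReal_one, one_mul, show 2 * (Real.pi : ℂ) * Complex.I * (θ : ℂ)
    = ((2 * Real.pi * θ : ℝ) : ℂ) * Complex.I by push_cast; ring, Complex.norm_exp_ofReal_mul_I]

theorem rayPoint_eq_mul (θ r : ℝ) : rayPoint θ r = (r : ℂ) * rayPoint θ 1 := by
  simp [rayPoint]

theorem summable_shifted_pow_mul_geometric (n : ℕ) {y : ℝ} (hy0 : 0 < y) (hy1 : y < 1) :
    Summable fun k : ℕ => ((k : ℝ) + 1) ^ n * y ^ k := by
  have h := (summable_nat_add_iff 1).2 (summable_pow_mul_geometric_of_norm_lt_one n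
    (r := y) (by rwa [Real.norm_of_nonneg hy0.le]))
  refine (h.mul_right y⁻¹).congr fun k => ?_
  push_cast
  rw [pow_succ]
  field_simp

/-- The coefficients of the nonlinear part of `F lam`, depending holomorphically on `lam`. -/
theorem exists_nonlinear_coeff {lam₀ : ℂ} {W : Set (ℂ × (ℂ × ℂ))} (hW : IsOpen W)
    (hW_mem : (lam₀, ((0, 0) : ℂ × ℂ)) ∈ W) {F : ℂ → ℂ × ℂ → ℂ × ℂ}
    (hF_hol : DifferentiableOn ℂ (fun p : ℂ × (ℂ × ℂ) => F p.1 p.2) W)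
    (hF_fst : ∀ lam : ℂ, (lam, ((0, 0) : ℂ × ℂ)) ∈ W →
      (fun z : ℂ × ℂ => (F lam z).1 - lam * z.1) =O[𝓝 (0, 0)] (fun z => ‖z‖ ^ 2))
    (hF_snd : ∀ lam : ℂ, (lam, ((0, 0) : ℂ × ℂ)) ∈ W →
      (fun z : ℂ × ℂ => (F lam z).2 - z.2) =O[𝓝 (0, 0)] (fun z => ‖z‖ ^ 2)) :
    ∃ ε R M : ℝ, 0 < ε ∧ ε ≤ 1 / 2 ∧ 0 < R ∧ 0 < M ∧
      (∀ z ∈ Metric.ball lam₀ ε, ∀ w ∈ Metric.ball (0 : ℂ × ℂ) R, (z, w) ∈ W) ∧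
      ∃ c₁ c₂ : ℕ → ℕ → ℂ → ℂ,
        (∀ p q, DifferentiableOn ℂ (c₁ p q) (Metric.ball lam₀ ε)) ∧
        (∀ p q, DifferentiableOn ℂ (c₂ p q) (Metric.ball lam₀ ε)) ∧
        (∀ p q, ∀ z ∈ Metric.ball lam₀ ε, ‖c₁ p q z‖ ≤ M * R⁻¹ ^ (p + q)) ∧
        (∀ p q, ∀ z ∈ Metric.ball lam₀ ε, ‖c₂ p q z‖ ≤ M * R⁻¹ ^ (p + q)) ∧
        (∀ p q z, p + q < 2 → c₁ p q z = 0 ∧ c₂ p q z = 0) ∧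
        ∀ z ∈ Metric.ball lam₀ ε, ∀ w ∈ Metric.ball (0 : ℂ × ℂ) R,
          HasSum (fun x : ℕ × ℕ => c₁ x.1 x.2 z * (w.1 ^ x.1 * w.2 ^ x.2))
            ((F z w).1 - z * w.1) ∧
          HasSum (fun x : ℕ × ℕ => c₂ x.1 x.2 z * (w.1 ^ x.1 * w.2 ^ x.2))
            ((F z w).2 - w.2) := by
  -- a polydisc on which the map is bounded
  have hnear : ∀ᶠ p in 𝓝 ((lam₀, ((0, 0) : ℂ × ℂ))), p ∈ W ∧ ‖F p.1 p.2‖ < ‖F lam₀ (0, 0)‖ + 1 :=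
    (hW.eventually_mem hW_mem).and ((hF_hol.differentiableAt
      (hW.mem_nhds hW_mem)).continuousAt.norm.eventually_lt continuousAt_const (by simp))
  obtain ⟨ε', hε', hball'⟩ := Metric.eventually_nhds_iff_ball.1 hnear
  set M : ℝ := ‖F lam₀ (0, 0)‖ + 1 with hM
  have hM0 : 0 < M := by positivity
  obtain ⟨ε, hε, hε2, hεε'⟩ : ∃ ε : ℝ, 0 < ε ∧ ε ≤ 1 / 2 ∧ ε ≤ ε' :=
    ⟨min (1 / 2) ε', lt_min (by norm_num) hε', min_le_left _ _, min_le_right _ _⟩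
  have hball : ∀ z ∈ Metric.ball lam₀ ε, ∀ w ∈ Metric.ball (0 : ℂ × ℂ) ε,
      (z, w) ∈ W ∧ ‖F z w‖ < M := fun z hz w hw => hball' (z, w) (by
    rw [← ball_prod_same]
    exact ⟨Metric.ball_subset_ball hεε' hz, Metric.ball_subset_ball hεε' hw⟩)
  set R : ℝ := ε / 2
  have hR : 0 < R := by positivity
  obtain ⟨f, hfd, hfM, hfsum⟩ := exists_taylorCoeff (U := Metric.ball lam₀ ε) Metric.isOpen_ball
    hR (half_lt_self hε) (F := F) (M := M)
    (hF_hol.mono fun p hp => (hball p.1 hp.1 p.2 hp.2).1)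
    (fun z hz w hw => (hball z hz w hw).2.le)
  -- the coefficients of the nonlinear part
  set c₁ : ℕ → ℕ → ℂ → ℂ := fun p q z => if 2 ≤ p + q then (f p q z).1 else 0 with hc₁
  set c₂ : ℕ → ℕ → ℂ → ℂ := fun p q z => if 2 ≤ p + q then (f p q z).2 else 0 with hc₂
  have hd₁ : ∀ p q, DifferentiableOn ℂ (c₁ p q) (Metric.ball lam₀ ε) := by
    intro p q
    by_cases h : 2 ≤ p + q
    · simp only [hc₁, h, if_true]; exact (hfd p q).fst
    · simp only [hc₁, h, if_false]; exact differentiableOn_const 0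
  have hd₂ : ∀ p q, DifferentiableOn ℂ (c₂ p q) (Metric.ball lam₀ ε) := by
    intro p q
    by_cases h : 2 ≤ p + q
    · simp only [hc₂, h, if_true]; exact (hfd p q).snd
    · simp only [hc₂, h, if_false]; exact differentiableOn_const 0
  have hb₁ : ∀ p q, ∀ z ∈ Metric.ball lam₀ ε, ‖c₁ p q z‖ ≤ M * R⁻¹ ^ (p + q) := by
    intro p q z hz
    by_cases h : 2 ≤ p + q
    · simp only [hc₁, h, if_true]; exact (norm_fst_le _).trans (hfM p q z hz)
    · simp only [hc₁, h, if_false, norm_zero]; positivity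
  have hb₂ : ∀ p q, ∀ z ∈ Metric.ball lam₀ ε, ‖c₂ p q z‖ ≤ M * R⁻¹ ^ (p + q) := by
    intro p q z hz
    by_cases h : 2 ≤ p + q
    · simp only [hc₂, h, if_true]; exact (norm_snd_le _).trans (hfM p q z hz)
    · simp only [hc₂, h, if_false, norm_zero]; positivity
  have hWmem : ∀ z ∈ Metric.ball lam₀ ε, ∀ w ∈ Metric.ball (0 : ℂ × ℂ) R, (z, w) ∈ W :=
    fun z hz w hw => (hball z hz w (Metric.ball_subset_ball (half_le_self hε.le) hw)).1
  refine ⟨ε, R, M, hε, hε2, hR, hM0, hWmem, c₁, c₂, hd₁, hd₂, hb₁, hb₂,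
    fun p q z h => ⟨if_neg (by omega), if_neg (by omega)⟩, fun z hz w hw => ?_⟩
  have h0 := hWmem z hz 0 (Metric.mem_ball_self hR)
  exact hasSum_nonlinear_part (f := fun p q => f p q z) (G := F z) hR (hfsum z hz)
    (hF_fst z h0) (hF_snd z h0) hw

theorem mainTheorem2 (θ₀ : ℝ) (hθ_pos : 0 < θ₀) (hθ_lt : θ₀ < 1) (hθ_irr : Irrational θ₀)
    (hθ : SiegelCondition (rayPoint θ₀ 1))
    (W : Set (ℂ × (ℂ × ℂ))) (hW : IsOpen W)
    (hW_mem : (rayPoint θ₀ 1, ((0, 0) : ℂ × ℂ)) ∈ W)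
    (F : ℂ → ℂ × ℂ → ℂ × ℂ)
    (hF_hol : DifferentiableOn ℂ (fun p : ℂ × (ℂ × ℂ) => F p.1 p.2) W)
    (hF_fst : ∀ lam : ℂ, (lam, ((0, 0) : ℂ × ℂ)) ∈ W →
      (fun z : ℂ × ℂ => (F lam z).1 - lam * z.1) =O[𝓝 (0, 0)] (fun z => ‖z‖ ^ 2))
    (hF_snd : ∀ lam : ℂ, (lam, ((0, 0) : ℂ × ℂ)) ∈ W →
      (fun z : ℂ × ℂ => (F lam z).2 - z.2) =O[𝓝 (0, 0)] (fun z => ‖z‖ ^ 2)) :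
    ∃ δ : ℝ, 0 < δ ∧ δ < 1 ∧ ∃ ρ : ℝ, 0 < ρ ∧ ∃ C : ℝ, ∃ ψ : ℝ → ℂ → ℂ × ℂ,
      (∀ r ∈ Set.Ioo (1 - δ) (1 + δ),
        DifferentiableOn ℂ (ψ r) (Metric.ball 0 ρ) ∧
        Set.InjOn (ψ r) (Metric.ball 0 ρ) ∧
        (∀ w ∈ Metric.ball (0 : ℂ) ρ, deriv (ψ r) w ≠ 0) ∧
        ψ r 0 = (0, 0) ∧
        HasDerivAt (ψ r) (1, 0) 0 ∧
        (∀ w ∈ Metric.ball (0 : ℂ) ρ, (rayPoint θ₀ r, ψ r w) ∈ W) ∧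
        (∀ w ∈ Metric.ball (0 : ℂ) ρ, rayPoint θ₀ r * w ∈ Metric.ball (0 : ℂ) ρ →
          F (rayPoint θ₀ r) (ψ r w) = ψ r (rayPoint θ₀ r * w))) ∧
      (∀ r ∈ Set.Ioo (1 - δ) (1 + δ), ∀ w ∈ Metric.ball (0 : ℂ) ρ, ‖ψ r w‖ < C) ∧
      IsC1HolomorphicFamily ψ (Set.Ioo (1 - δ) (1 + δ)) (Metric.ball 0 ρ) := by
  obtain ⟨c, hc, N, hN, hd⟩ := exists_nat_siegelCondition hθ
  have hlam := norm_rayPoint_one θ₀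
  set lam₀ := rayPoint θ₀ 1 with hlam₀
  obtain ⟨ε, R, M, hε, hε2, hR, hM0, hWmem, c₁, c₂, hd₁, hd₂, hb₁, hb₂, hc0, hsum⟩ :=
    exists_nonlinear_coeff hW hW_mem hF_hol hF_fst hF_snd
  obtain ⟨ρ₀, C, τ, hρ₀, hρR, hC, hτ, hτ1, htube⟩ :=
    invariantSeries_tube hlam hc hN hd hε hε2 hR hM0 hd₁ hd₂ hb₁ hb₂
  set α : ℕ → ℂ → ℂ × ℂ := fun k ζ =>
    (PowerSeries.coeff k (invariantSeries c₁ c₂ (ζ * lam₀)).1,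
      PowerSeries.coeff k (invariantSeries c₁ c₂ (ζ * lam₀)).2) with hα
  -- The coefficient bound becomes geometric of ratio `C / ρ₀ * ρ = y = 1 / (128 * C)`. The second
  -- factor `C` compensates the one left over when `ρ ^ (k - 1)` replaces `ρ ^ k` in the immersion
  -- criterion, where `C * y = 1 / 128` is used.
  set ρ : ℝ := ρ₀ / (128 * C ^ 2) with hρdef
  have hC0 : 0 < C := by linarith
  have hρ : 0 < ρ := by positivity
  set y : ℝ := 1 / (128 * C) with hy
  have hy0 : 0 < y := by positivity
  have hCy : C * y = 1 / 128 := by rw [hy]; field_simp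
  have hy1 : y ≤ 1 / 128 := by nlinarith
  have hρy : C / ρ₀ * ρ = y := by rw [hρdef, hy]; field_simp
  set t : ℕ → ℝ := fun k => τ / ((k : ℝ) + 1) ^ (N + 1) with ht
  have ht0 : ∀ k, 0 < t k := fun k => by positivity
  have ht1 : ∀ k, t k ≤ 1 := fun k =>
    (div_le_self hτ.le (one_le_pow₀ (by linarith [(Nat.cast_nonneg k : (0 : ℝ) ≤ k)]))).trans hτ1
  have hI : ∀ r ∈ Set.Ioo (1 - ε / 2) (1 + ε / 2), |r - 1| < ε / 2 := fun r hr =>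
    abs_lt.2 ⟨by linarith [hr.1], by linarith [hr.2]⟩
  have hBy : ∀ k, 2 * ρ₀ * (C / ρ₀) ^ k * ρ ^ k = 2 * ρ₀ * y ^ k := fun k => by
    rw [mul_assoc, ← mul_pow, hρy]
  have hC1 : IsC1HolomorphicFamily (fun r w => ∑' k, w ^ k • α k r)
      (Set.Ioo (1 - ε / 2) (1 + ε / 2)) (Metric.ball 0 ρ) := by
    refine isC1HolomorphicFamily_tsum (t := t) (B := fun k => 2 * ρ₀ * (C / ρ₀) ^ k)
      (convex_Ioo _ _) ht0 ht1
      (fun k r hr ζ hζ => (htube r (hI r hr) k ζ hζ).2.2.2.differentiableWithinAt)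
      (fun k r hr ζ hζ => (htube r (hI r hr) k ζ hζ).2.2.1) ?_
    -- Dividing by `t k ^ 2` costs the polynomial factor `(k + 1) ^ (2 * (N + 1))`, harmless against
    -- `y ^ k`.
    refine ((summable_shifted_pow_mul_geometric (2 * (N + 1)) hy0 (by linarith)).mul_left
      (2 * ρ₀ / τ ^ 2)).congr fun k => ?_
    calc 2 * ρ₀ / τ ^ 2 * (((k : ℝ) + 1) ^ (2 * (N + 1)) * y ^ k)
        = 2 * ρ₀ * y ^ k / t k ^ 2 := by
          simp only [ht, div_pow, ← pow_mul, mul_comm (N + 1) 2]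
          field_simp
      _ = 2 * ρ₀ * (C / ρ₀) ^ k / t k ^ 2 * ρ ^ k := by rw [← hBy]; ring
  have hbound : ∀ r ∈ Set.Ioo (1 - ε / 2) (1 + ε / 2), ∀ k,
      ‖α k r‖ ≤ 2 * ρ₀ * (C / ρ₀) ^ k := fun r hr k =>
    (htube r (hI r hr) k r (Metric.mem_ball_self (ht0 k))).2.2.1
  have hgeo : HasSum (fun k : ℕ => 2 * ρ₀ * (1 / 2) ^ k) (4 * ρ₀) := by
    have := (hasSum_geometric_of_lt_one (by norm_num)
      (by norm_num : (1 / 2 : ℝ) < 1)).mul_left (2 * ρ₀)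
    rwa [show 2 * ρ₀ * (1 - 1 / 2)⁻¹ = 4 * ρ₀ by ring] at this
  have habs : ∀ {P : PowerSeries ℂ}, (∀ k, ‖PowerSeries.coeff k P‖ ≤ 2 * ρ₀ * (C / ρ₀) ^ k) →
      ∀ w ∈ Metric.ball (0 : ℂ) ρ,
        HasAbsSum P w (∑' k, PowerSeries.coeff k P * w ^ k) (4 * ρ₀) := by
    intro P hP w hw
    have h : ∀ k, ‖PowerSeries.coeff k P * w ^ k‖ ≤ 2 * ρ₀ * (1 / 2) ^ k := by
      intro k
      rw [norm_mul, norm_pow]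
      calc ‖PowerSeries.coeff k P‖ * ‖w‖ ^ k ≤ 2 * ρ₀ * (C / ρ₀) ^ k * ρ ^ k :=
            mul_le_mul (hP k) (pow_le_pow_left₀ (norm_nonneg _) (mem_ball_zero_iff.1 hw).le k)
              (by positivity) (by positivity)
        _ = 2 * ρ₀ * y ^ k := hBy k
        _ ≤ 2 * ρ₀ * (1 / 2) ^ k := by
            gcongr
            linarith
    have hs : Summable fun k => ‖PowerSeries.coeff k P * w ^ k‖ :=
      Summable.of_nonneg_of_le (fun _ => norm_nonneg _) h hgeo.summable
    exact ⟨hs, rfl, (hs.tsum_le_tsum h hgeo.summable).trans_eq hgeo.tsum_eq⟩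
  have hP : ∀ r ∈ Set.Ioo (1 - ε / 2) (1 + ε / 2), ∀ w ∈ Metric.ball (0 : ℂ) ρ,
      HasAbsSum (invariantSeries c₁ c₂ (r * lam₀)).1 w (∑' k, w ^ k • α k r).1 (4 * ρ₀) ∧
      HasAbsSum (invariantSeries c₁ c₂ (r * lam₀)).2 w (∑' k, w ^ k • α k r).2 (4 * ρ₀) ∧
      HasSum (fun k => w ^ k • α k r) (∑' k, w ^ k • α k r) := by
    intro r hr w hw
    have h1 := habs (fun k => (norm_fst_le _).trans (hbound r hr k)) w hw
    have h2 := habs (fun k => (norm_snd_le _).trans (hbound r hr k)) w hw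
    have h3 : HasSum (fun k => w ^ k • α k r)
        (∑' k, PowerSeries.coeff k (invariantSeries c₁ c₂ (r * lam₀)).1 * w ^ k,
          ∑' k, PowerSeries.coeff k (invariantSeries c₁ c₂ (r * lam₀)).2 * w ^ k) := by
      refine (h1.hasSum.prodMk h2.hasSum).congr_fun fun k => ?_
      simp [hα, mul_comm]
    rw [h3.tsum_eq]
    exact ⟨h1, h2, h3⟩
  have hnorm : ∀ r ∈ Set.Ioo (1 - ε / 2) (1 + ε / 2), ∀ w ∈ Metric.ball (0 : ℂ) ρ,
      ‖∑' k, w ^ k • α k r‖ ≤ 4 * ρ₀ := by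
    intro r hr w hw
    have hle : ∀ {P : PowerSeries ℂ} {x : ℂ}, HasAbsSum P w x (4 * ρ₀) → ‖x‖ ≤ 4 * ρ₀ :=
      fun h => h.2.1 ▸ (norm_tsum_le_tsum_norm h.1).trans h.2.2
    obtain ⟨h1, h2, -⟩ := hP r hr w hw
    rw [Prod.norm_def]
    exact max_le (hle h1) (hle h2)
  have hlt : 4 * ρ₀ < R := by linarith
  refine ⟨ε / 2, by positivity, by linarith, ρ, hρ, R, fun r w => ∑' k, w ^ k • α k r,
    fun r hr => ?_, fun r hr w hw => (hnorm r hr w hw).trans_lt hlt, hC1⟩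
  have hdiff := hC1.1 r hr
  have hlamr : (r : ℂ) * lam₀ ∈ Metric.ball lam₀ ε :=
    (htube r (hI r hr) 0 r (Metric.mem_ball_self (ht0 0))).1
  have hinj := injective_immersion_of_small (a := fun k => α k r) hρ
    (fun w hw => (hP r hr w hw).2.2)
    (fun w hw => hdiff.differentiableAt (Metric.isOpen_ball.mem_nhds hw))
    (Prod.ext (coeff_zero_formalSol _ _ _ _).1 (coeff_zero_formalSol _ _ _ _).2)
    (Prod.ext (coeff_one_formalSol _ _ _ _).1 (coeff_one_formalSol _ _ _ _).2)
    (fun k hk => by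
      obtain ⟨m, rfl⟩ := Nat.exists_eq_add_of_le' hk
      have h1 : ((m + 2 : ℕ) : ℝ) ≤ 2 * 2 ^ m := by
        rw [← pow_succ']
        exact_mod_cast Nat.succ_le_of_lt (Nat.lt_two_pow_self (n := m + 1))
      calc ‖α (m + 2) r‖ * (((m + 2 : ℕ) : ℝ) * ρ ^ (m + 2 - 1))
          ≤ 2 * ρ₀ * (C / ρ₀) ^ (m + 2) * ((2 * 2 ^ m) * ρ ^ (m + 2 - 1)) := by
            have := hbound r hr (m + 2)
            gcongr
        _ = 4 * (ρ₀ * (C / ρ₀)) * ((C / ρ₀ * ρ) * (2 * (C / ρ₀ * ρ)) ^ m) := by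
            rw [show m + 2 - 1 = m + 1 by omega]
            simp only [mul_pow, pow_succ]
            ring
        _ = 4 * (C * y) * (2 * y) ^ m := by
            rw [hρy, mul_div_cancel₀ C hρ₀.ne']
            ring
        _ ≤ 4 * (1 / 128) * (1 / 2) ^ m := by
            rw [hCy]
            gcongr
            linarith
        _ ≤ 1 / 4 * (1 / 2) ^ (m + 2) := by
            rw [pow_add]
            have : (0 : ℝ) < (1 / 2) ^ m := by positivity
            linarith)
  have hmem : ∀ w ∈ Metric.ball (0 : ℂ) ρ, ∑' k, w ^ k • α k r ∈ Metric.ball (0 : ℂ × ℂ) R :=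
    fun w hw => mem_ball_zero_iff.2 ((hnorm r hr w hw).trans_lt hlt)
  rw [rayPoint_eq_mul]
  refine ⟨hdiff, hinj.1, hinj.2.1, hinj.2.2.1, hinj.2.2.2, fun w hw => hWmem _ hlamr _ (hmem w hw),
    fun w hw hw' => ?_⟩
  obtain ⟨x₁, x₂, -⟩ := hP r hr w hw
  obtain ⟨y₁, y₂, -⟩ := hP r hr _ hw'
  obtain ⟨s₁, s₂⟩ := hsum _ hlamr _ (hmem w hw)
  exact invariantSeries_functional
    -- The point `r` is the centre of the disc of every index, so on the ray itself no divisor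
    -- vanishes and the recursion holds at all orders.
    (fun j hj => (htube r (hI r hr) j r (Metric.mem_ball_self (ht0 j))).2.1 j hj (by omega))
    hR hlt (fun p q h => (hc0 p q _ h).1) (fun p q h => (hc0 p q _ h).2)
    (fun p q => hb₁ p q _ hlamr) (fun p q => hb₂ p q _ hlamr) x₁ x₂ y₁ y₂ s₁ s₂
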